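/- Let $H$ be a separable real Hilbert space, $p\ge 2$, $\beta>0$, and let $\mathcal P_p(H)$ be the set of Borel probability measures $\mu$ on $H$ with $\|\mu\|_p:=\left(\int_H|x|_H^p\,\mu(dx)\right)^{1/p}<\infty$, with the Wasserstein distance $W_p(\mu,\nu)=\inf_{\Pi}\left(\int_{H\times H}|x-y|_H^p\,\Pi(dx,dy)\right)^{1/p}$, the infimum being over all couplings $\Pi$ of $\mu$ and $\nu$. Let $\Theta_{s,t}:\mathcal P_p(H)\to\mathcal P_p(H)$, $0\le s\le t$, be a family of maps with $\Theta_{t,t}=\mathrm{Id}$. **$\beta$-sewing property with constants $L_{sew},C_{sew}>0$.** There are a probability space $(\Omega,\mathcal F,\mathbb P)$ with a filtration $(\mathcal F_t)_{t\ge0}$, such that there is an $\mathcal F_0$-measurable random variable uniformly distributed on $[0,1]$, and operators $$\mathcal X_{s,r,t}=(\mathcal X^1_{s,r,t},\mathcal X^2_{s,r,t}):L^p_s(H)\times L^p_s(H)\to L^p_t(H)\times L^p_t(H),\qquad 0\le s\le r\le t,$$ where $L^p_t(H)$ is the space of $\mathcal F_t$-measurable $X:\Omega\to H$ with $\|X\|_p:=\mathbb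 E[|X|_H^p]^{1/p}<\infty$, such that the following holds for all $s\le r\le t$ and $X=(X^1,X^2)\in L^p_s(H)\times L^p_s(H)$, where $\|X\|_p=\|X^1\|_p+\|X^2\|_p$ and, for $\ell\in\{1,2\}$, $\mathcal E^\ell=\mathcal X^\ell_{s,r,t}(X)-X^\ell$, $\widehat{\mathcal E}^\ell=\mathbb E[\mathcal E^\ell\mid\mathcal F_s]$, $\widetilde{\mathcal E}^\ell=\mathcal E^\ell-\widehat{\mathcal E}^\ell$: * (R) if $X^1$ and $X^2$ have laws $\mu^1$ and $\mu^2$, then $\mathcal X^1_{s,r,t}(X)$ has law $\Theta_{s,t}(\mu^1)$ and $\mathcal X^2_{s,r,t}(X)$ has law $\Theta_{r,t}\circ\Theta_{s,r}(\mu^2)$; * (G) $\|\widehat{\mathcal E}^1\|_p\le L_{sew}(t-s)(1+\|X^1\|_p)$ and $\|\widetilde{\mathcal E}^1\|_p\le L_{sew}(t-s)^{1/2}(1+\|X^1\|_p)$; * (S($\beta$)) $\|\widehat{\mathcal E}^2-\widehat{\mathcal E}^1\|_p\le C_{sew}(t-s)\big(\|X^1-X^2\|_p+(1+\|X\|_p)(t-s)^\beta\big)$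 and $\|\widetilde{\mathcal E}^2-\widetilde{\mathcal E}^1\|_p\le C_{sew}(t-s)^{1/2}\big(\|X^1-X^2\|_p+(1+\|X\|_p)(t-s)^\beta\big)$. **Continuity property (C).** There is a nondecreasing $\varphi:[0,\infty)\to[0,\infty)$ with $\lim_{\delta\to0}\varphi(\delta)=0$ such that $W_p(\Theta_{s,t}(\mu),\mu)\le(1+\|\mu\|_p)\,\varphi(t-s)$ for all $s<t$ and $\mu\in\mathcal P_p(H)$. **Dyadic schemes.** For $n\in\mathbb N$ let $\eta_n(t)=2^{-n}\lfloor 2^nt\rfloor$ and, for $s<t$, $$\Theta^n_{s,t}=\Theta_{\eta_n(t)-2^{-n},\,\eta_n(t)}\circ\dots\circ\Theta_{\eta_n(s),\,\eta_n(s)+2^{-n}},$$ with $\Theta^n_{s,t}=\mathrm{Id}$ if $\eta_n(s)=\eta_n(t)$. **Theorem.** There are constants $A_T\in[0,\infty)$, depending only on $T,p,L_{sew}$, and $C_T\in[0,\infty)$, depending only on $T,p,L_{sew},C_{sew}$, such that the following holds. If $\Theta$ has the $\beta$-sewing property with constants $L_{sew},C_{sew}$ and the continuity property (C), then there exist maps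 $\theta_{s,t}:\mathcal P_p(H)\to\mathcal P_p(H)$, $0\le s\le t$, with the flow property $\theta_{s,t}=\theta_{r,t}\circ\theta_{s,r}$ for $s\le r\le t$, and such that $W_p(\Theta^n_{s,t}(\mu),\theta_{s,t}(\mu))\to0$ as $n\to\infty$ for all $s<t$ and $\mu\in\mathcal P_p(H)$. Moreover, for every $T>0$: * $\|\theta_{s,t}(\mu)\|_p\le A_T(1+\|\mu\|_p)$ for all $0\le s<t\le T$ and $\mu\in\mathcal P_p(H)$; * $W_p(\theta_{s,t}(\mu),\theta_{s,t}(\nu))\le C_T\,W_p(\mu,\nu)$ for all $0\le s<t\le T$ and $\mu,\nu\in\mathcal P_p(H)$; * $(s,t)\mapsto\theta_{s,t}(\mu)$ is uniformly continuous on $\{0\le s<t\le T\}$, uniformly in $\mu$ relative to $1+\|\mu\|_p$: for every $\varepsilon>0$ there is $\delta>0$ such that $W_p(\theta_{s,t}(\mu),\theta_{s',t'}(\mu))\le\varepsilon(1+\|\mu\|_p)$ for all $\mu\in\mathcal P_p(H)$ and all $0\le s<t\le T$, $0\le s'<t'\le T$ with $|s-s'|<\delta$ and $|t-t'|<\delta$.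 -/

import Mathlib

open MeasureTheory Filter Topology
open scoped NNReal ENNReal

universe u v

namespace WassersteinSewing

/-- The set `P_p(H)` of Borel probability measures on `H` with finite `p`-th moment (`0 < p < ∞`):
`eLpNorm (fun x => x) p μ = (∫ ‖x‖^p μ(dx))^(1/p)`. -/
abbrev PMoment (H : Type u) [NormedAddCommGroup H] [MeasurableSpace H] (p : ℝ≥0) : Type u :=
  {μ : Measure H // IsProbabilityMeasure μ ∧ eLpNorm (fun x : H => x) p μ < ∞}

section Measures

variable {H : Type u} [NormedAddCommGroup H] [MeasurableSpace H] {p : ℝ≥0}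

/-- `‖μ‖_p = (∫ ‖x‖^p μ(dx))^(1/p)`. -/
noncomputable def moment (μ : PMoment H p) : ℝ≥0∞ :=
  eLpNorm (fun x : H => x) p μ.1

/-- The couplings of `μ` and `ν`: measures on `H × H` with marginals `μ` and `ν`. Such a measure is
automatically a probability measure with finite `p`-th moment. -/
def couplings (μ ν : PMoment H p) : Set (Measure (H × H)) :=
  {Q | Q.map Prod.fst = μ.1 ∧ Q.map Prod.snd = ν.1}

/-- The Wasserstein distance `W_p(μ,ν) = inf_Q (∫ ‖x - y‖^p Q(dx,dy))^(1/p)` over the couplings `Q`,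
as an extended nonnegative real (it is finite on `P_p(H)`). -/
noncomputable def wasserstein (μ ν : PMoment H p) : ℝ≥0∞ :=
  ⨅ Q ∈ couplings μ ν, eLpNorm (fun z : H × H => z.1 - z.2) p Q

end Measures

section Coupling

/-- `L^p_t(H)`: the `ℱ_t`-measurable random variables `X : Ω → H` with `‖X‖_p < ∞`. -/
abbrev LpAt (H : Type u) [NormedAddCommGroup H] [MeasurableSpace H] {Ω : Type v}
    {mΩ : MeasurableSpace Ω} (ℱ : Filtration ℝ≥0 mΩ) (P : Measure Ω) (p : ℝ≥0) (t : ℝ≥0) :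
    Type (max u v) :=
  {X : Ω → H // Measurable[ℱ t] X ∧ eLpNorm X p P < ∞}

variable {H : Type u} [NormedAddCommGroup H] [InnerProductSpace ℝ H] [CompleteSpace H]
  [MeasurableSpace H] {p : ℝ≥0} {Ω : Type v} {mΩ : MeasurableSpace Ω}
  {ℱ : Filtration ℝ≥0 mΩ} {P : Measure Ω}

/-- The `ℱ_s`-conditional mean `E[Y - X | ℱ_s]` of the increment from `X` to `Y`. -/
noncomputable def meanPart (ℱ : Filtration ℝ≥0 mΩ) (P : Measure Ω) (s : ℝ≥0) (X Y : Ω → H) :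
    Ω → H :=
  P[Y - X | ℱ s]

/-- The martingale part `(Y - X) - E[Y - X | ℱ_s]` of the increment from `X` to `Y`. -/
noncomputable def martPart (ℱ : Filtration ℝ≥0 mΩ) (P : Measure Ω) (s : ℝ≥0) (X Y : Ω → H) :
    Ω → H :=
  (Y - X) - P[Y - X | ℱ s]

/-- A family of operators `𝒳_{s,r,t} : L^p_s(H) × L^p_s(H) → L^p_t(H) × L^p_t(H)`, `s ≤ r ≤ t`.
(The values for other triples of times are never used.) -/
abbrev OperatorFamily (H : Type u) [NormedAddCommGroup H] [MeasurableSpace H] {Ω : Type v}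
    {mΩ : MeasurableSpace Ω} (ℱ : Filtration ℝ≥0 mΩ) (P : Measure Ω) (p : ℝ≥0) :
    Type (max u v) :=
  ∀ s _r t : ℝ≥0, LpAt H ℱ P p s × LpAt H ℱ P p s → LpAt H ℱ P p t × LpAt H ℱ P p t

/-- `𝒳` is a `β`-coupling family of operators for `Θ`, with growth constant `L` and sewing
constant `C`. -/
structure IsCouplingFamily (Θ : ℝ≥0 → ℝ≥0 → PMoment H p → PMoment H p)
    (𝒳 : OperatorFamily H ℱ P p) (β : ℝ) (L C : ℝ≥0) : Prop where
  /-- Representation property, first component: `Θ_{s,t}(μ¹)` is the law of `𝒳¹_{s,r,t}(X¹,X²)`. -/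
  repr_fst : ∀ s r t : ℝ≥0, s ≤ r → r ≤ t → ∀ (μ : PMoment H p)
    (X : LpAt H ℱ P p s × LpAt H ℱ P p s), P.map X.1.1 = μ.1 →
      P.map (𝒳 s r t X).1.1 = (Θ s t μ).1
  /-- Representation property, second component: `Θ_{r,t} ∘ Θ_{s,r}(μ²)` is the law of
  `𝒳²_{s,r,t}(X¹,X²)`. -/
  repr_snd : ∀ s r t : ℝ≥0, s ≤ r → r ≤ t → ∀ (μ : PMoment H p)
    (X : LpAt H ℱ P p s × LpAt H ℱ P p s), P.map X.2.1 = μ.1 →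
      P.map (𝒳 s r t X).2.1 = (Θ r t (Θ s r μ)).1
  growth_mean : ∀ s r t : ℝ≥0, s ≤ r → r ≤ t → ∀ X : LpAt H ℱ P p s × LpAt H ℱ P p s,
    eLpNorm (meanPart ℱ P s X.1.1 (𝒳 s r t X).1.1) p P
      ≤ (L * (t - s) : ℝ≥0) * (1 + eLpNorm X.1.1 p P)
  growth_mart : ∀ s r t : ℝ≥0, s ≤ r → r ≤ t → ∀ X : LpAt H ℱ P p s × LpAt H ℱ P p s,
    eLpNorm (martPart ℱ P s X.1.1 (𝒳 s r t X).1.1) p P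
      ≤ (L * (t - s) ^ (1 / 2 : ℝ) : ℝ≥0) * (1 + eLpNorm X.1.1 p P)
  sewing_mean : ∀ s r t : ℝ≥0, s ≤ r → r ≤ t → ∀ X : LpAt H ℱ P p s × LpAt H ℱ P p s,
    eLpNorm (meanPart ℱ P s X.2.1 (𝒳 s r t X).2.1 - meanPart ℱ P s X.1.1 (𝒳 s r t X).1.1) p P
      ≤ (C * (t - s) : ℝ≥0) * (eLpNorm (X.1.1 - X.2.1) p P
          + (1 + (eLpNorm X.1.1 p P + eLpNorm X.2.1 p P)) * ((t - s) ^ β : ℝ≥0))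
  sewing_mart : ∀ s r t : ℝ≥0, s ≤ r → r ≤ t → ∀ X : LpAt H ℱ P p s × LpAt H ℱ P p s,
    eLpNorm (martPart ℱ P s X.2.1 (𝒳 s r t X).2.1 - martPart ℱ P s X.1.1 (𝒳 s r t X).1.1) p P
      ≤ (C * (t - s) ^ (1 / 2 : ℝ) : ℝ≥0) * (eLpNorm (X.1.1 - X.2.1) p P
          + (1 + (eLpNorm X.1.1 p P + eLpNorm X.2.1 p P)) * ((t - s) ^ β : ℝ≥0))

end Coupling

section Schemes

variable {H : Type u} [NormedAddCommGroup H] [MeasurableSpace H] {p : ℝ≥0}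

/-- The continuity property of `Θ` on the diagonal: there is a nondecreasing
`φ : [0,∞) → [0,∞)` with limit `0` at `0` such that
`W_p(Θ_{s,t}(μ), μ) ≤ (1 + ‖μ‖_p) φ(t - s)` for all `s < t` and all `μ`. -/
def ContinuityProperty (Θ : ℝ≥0 → ℝ≥0 → PMoment H p → PMoment H p) : Prop :=
  ∃ φ : ℝ≥0 → ℝ≥0, Monotone φ ∧ Tendsto φ (𝓝[>] 0) (𝓝 0) ∧
    ∀ s t : ℝ≥0, s < t → ∀ μ : PMoment H p,
      wasserstein (Θ s t μ) μ ≤ (1 + moment μ) * (φ (t - s) : ℝ≥0)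

/-- `Θ_{a_{N-1},a_N} ∘ ⋯ ∘ Θ_{a_0,a_1}`, the scheme along the grid `a_0 < ⋯ < a_N`
(the identity if `N = 0`). -/
def gridScheme (Θ : ℝ≥0 → ℝ≥0 → PMoment H p → PMoment H p) (a : ℕ → ℝ≥0) :
    ℕ → PMoment H p → PMoment H p
  | 0 => id
  | N + 1 => Θ (a N) (a (N + 1)) ∘ gridScheme Θ a N

/-- The dyadic scheme `Θ^n_{s,t}`: the scheme along the grid of step `2^{-n}` going from
`⌊2^n s⌋ / 2^n` to `⌊2^n t⌋ / 2^n`. -/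
noncomputable def dyadicScheme (Θ : ℝ≥0 → ℝ≥0 → PMoment H p → PMoment H p) (n : ℕ)
    (s t : ℝ≥0) : PMoment H p → PMoment H p :=
  gridScheme Θ (fun i => ((⌊2 ^ n * s⌋₊ + i : ℕ) : ℝ≥0) / 2 ^ n) (⌊2 ^ n * t⌋₊ - ⌊2 ^ n * s⌋₊)

end Schemes

/-- `Θ` has the `β`-sewing property with constants `L` and `C`: on some filtered probability
space such that `ℱ_0` carries a uniform random variable, there is a `β`-coupling family
for `Θ` with growth constant `L` and sewing constant `C`. -/
def SewingProperty {H : Type u} [NormedAddCommGroup H] [InnerProductSpace ℝ H] [CompleteSpace H]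
    [MeasurableSpace H] {p : ℝ≥0} (Θ : ℝ≥0 → ℝ≥0 → PMoment H p → PMoment H p)
    (β : ℝ) (L C : ℝ≥0) : Prop :=
  ∃ (Ω : Type v) (mΩ : MeasurableSpace Ω) (P : Measure Ω) (_ : IsProbabilityMeasure P)
    (ℱ : Filtration ℝ≥0 mΩ),
    (∃ U : Ω → ℝ, Measurable[ℱ 0] U ∧ P.map U = volume.restrict (Set.Icc 0 1)) ∧
    ∃ 𝒳 : OperatorFamily H ℱ P p, IsCouplingFamily Θ 𝒳 β L C

end WassersteinSewing

set_option linter.unusedSectionVars false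

/-! The engine is a Gronwall argument for squared `L^p` norms. For `p ≥ 2` the `L^p` norm of
Hilbert-valued variables is 2-smooth: if `Z` is known at time `s` and an increment has conditional
mean of size `M` and martingale part of size `V`, the squared norm of the sum is at most `(‖Z‖ + M)²
+ c V²` (`eLpNorm_add_increment_sq_le`). In the growth and sewing bounds `M` is of order `h` and `V`
of order `√h`, so a step of length `h` contributes only `O(h)` to the square, and the contributions
multiply to at most `exp(O(T))` however many steps are taken.

The operators are run along a grid `b`, two intervals at a time, from a realization of an arbitrary
coupling of the initial laws. The first component then follows the scheme on the even points of `b`,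
the second the scheme on all of `b`, so Gronwall bounds their distance by the initial distance plus
a local error of order `δ^β` (`wasserstein_gridScheme_le`). This one estimate is used twice. If `b`
is a dyadic grid, it compares consecutive levels with an error of order `2^{-nβ}`, which is
summable. If every odd point of `b` is merged with the next even point, both components follow the
same scheme, and it gives Lipschitz stability up to an error that vanishes with the mesh
(`wasserstein_gridScheme_stability`). Growth and Hölder continuity of order 1/2 in time use the
first component alone.

Hence the dyadic schemes are Cauchy, and they converge because the Wasserstein space is complete
(`completeSpace_wasserstein`). At each level the scheme composes exactly along its grid; stability
carries this to the limit as the flow property (`limit_flow`). The Lipschitz, growth and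
time-continuity bounds pass to the limit in the same way. -/

namespace WassersteinSewing

/-! ### Second-order expansion of the `p`-th power of the norm -/

section Smoothness

/-- A second order Taylor bound for `y ↦ y ^ (r + 1)` around `1`. -/
lemma rpow_le_quadratic {r y : ℝ} (hr : 0 ≤ r) (hy₁ : 1 / 4 ≤ y) (hy₂ : y ≤ 9 / 4) :
    y ^ (r + 1) ≤ 1 + (r + 1) * (y - 1) + (r + 1) * (4 * r * (9 / 4) ^ r) * (y - 1) ^ 2 := by
  have hy : 0 < y := by linarith
  -- By convexity the tangent at `y` lies below the graph at `1`; this is Bernoulli's inequality at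
  -- `1 / y - 1` multiplied by `y ^ (r + 1)`. Its slope involves `y ^ r`, which `lip` replaces by
  -- `1` at a quadratic cost.
  have tangent : y ^ (r + 1) ≤ 1 + (r + 1) * y ^ r * (y - 1) := by
    have h := one_add_mul_self_le_rpow_one_add (s := 1 / y - 1) (p := r + 1)
      (by have : 0 < 1 / y := by positivity
          linarith) (by linarith)
    have h1 : (1 + (1 / y - 1)) ^ (r + 1) * y ^ (r + 1) = 1 := by
      rw [← Real.mul_rpow (by rw [add_sub_cancel]; positivity) hy.le]
      have : (1 + (1 / y - 1)) * y = 1 := by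
        rw [add_sub_cancel, one_div_mul_cancel hy.ne']
      rw [this, Real.one_rpow]
    have h2 := mul_le_mul_of_nonneg_right h (Real.rpow_nonneg hy.le (r + 1))
    rw [h1] at h2
    have h3 : y ^ (r + 1) = y ^ r * y := by rw [Real.rpow_add hy, Real.rpow_one]
    have h4 : (1 + (r + 1) * (1 / y - 1)) * y ^ (r + 1)
        = y ^ (r + 1) + (r + 1) * y ^ r * (1 - y) := by
      rw [h3]; field_simp
    rw [h4] at h2
    linarith
  have lip : ‖y ^ r - 1 ^ r‖ ≤ 4 * r * (9 / 4) ^ r * ‖y - 1‖ := by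
    refine Convex.norm_image_sub_le_of_norm_hasDerivWithin_le (f := fun x : ℝ => x ^ r)
      (f' := fun x => r * x ^ (r - 1)) (s := Set.Icc (1 / 4) (9 / 4)) ?_ ?_ (convex_Icc _ _)
      (by norm_num) ⟨hy₁, hy₂⟩
    · intro x hx
      have hx0 : x ≠ 0 := by have := hx.1; linarith
      exact (Real.hasDerivAt_rpow_const (Or.inl hx0)).hasDerivWithinAt
    · intro x hx
      have hx0 : 0 < x := by have := hx.1; linarith
      rw [Real.norm_of_nonneg (by positivity), Real.rpow_sub_one hx0.ne']
      have h1 : x ^ r ≤ (9 / 4) ^ r := Real.rpow_le_rpow hx0.le hx.2 hr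
      have h2 : x ^ r / x ≤ 4 * (9 / 4) ^ r := by
        rw [div_le_iff₀ hx0]
        have : (0 : ℝ) ≤ (9 / 4) ^ r := by positivity
        nlinarith [hx.1]
      calc r * (x ^ r / x) ≤ r * (4 * (9 / 4) ^ r) := by gcongr
        _ = _ := by ring
  rw [Real.one_rpow, Real.norm_eq_abs, Real.norm_eq_abs] at lip
  have h5 : (y ^ r - 1) * (y - 1) ≤ 4 * r * (9 / 4) ^ r * (y - 1) ^ 2 := by
    calc (y ^ r - 1) * (y - 1) ≤ |(y ^ r - 1) * (y - 1)| := le_abs_self _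
      _ = |y ^ r - 1| * |y - 1| := abs_mul _ _
      _ ≤ (4 * r * (9 / 4) ^ r * |y - 1|) * |y - 1| := by gcongr
      _ = 4 * r * (9 / 4) ^ r * (y - 1) ^ 2 := by rw [mul_assoc, ← sq, sq_abs]
  have h6 := mul_le_mul_of_nonneg_left h5 (by linarith : 0 ≤ r + 1)
  nlinarith

/-- The constant of the second order expansion of `z ↦ ‖z‖ ^ p` in a Hilbert space. -/
noncomputable def expansionConst (p : ℝ) : ℝ :=
  3 ^ p + p * 2 ^ (p - 1) + p / 2
    + p / 2 * (4 * (p / 2 - 1) * (9 / 4) ^ (p / 2 - 1)) * (25 / 4)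

lemma one_le_expansionConst {p : ℝ} (hp : 2 ≤ p) : 1 ≤ expansionConst p := by
  have h1 : (1 : ℝ) ≤ 3 ^ p := Real.one_le_rpow (by norm_num) (by linarith)
  have h2 : 0 ≤ p / 2 - 1 := by linarith
  have h3 : 0 ≤ p * 2 ^ (p - 1) + p / 2
    + p / 2 * (4 * (p / 2 - 1) * (9 / 4) ^ (p / 2 - 1)) * (25 / 4) := by positivity
  unfold expansionConst
  linarith

variable {H : Type*} [NormedAddCommGroup H] [InnerProductSpace ℝ H]

/-- Taylor's formula with the first-order term kept exactly, since that is the term a martingale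
increment kills after integration. -/
lemma norm_add_rpow_le {p : ℝ} (hp : 2 ≤ p) (z d : H) :
    ‖z + d‖ ^ p ≤ ‖z‖ ^ p + p * (‖z‖ ^ (p - 2) * inner ℝ z d)
      + expansionConst p * (‖z‖ ^ (p - 2) * ‖d‖ ^ 2 + ‖d‖ ^ p) := by
  have hp2 : 0 ≤ p - 2 := by linarith
  have hr : 0 ≤ p / 2 - 1 := by linarith
  have inner_le := abs_real_inner_le_norm z d
  set a := ‖z‖ with ha
  set b := ‖d‖ with hb
  have ha0 : 0 ≤ a := norm_nonneg _
  have hb0 : 0 ≤ b := norm_nonneg _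
  have split : ∀ x : ℝ, 0 ≤ x → x ^ p = x ^ (p - 2) * x ^ 2 := fun x hx => by
    rw [← Real.rpow_natCast x 2, ← Real.rpow_add_of_nonneg hx hp2 (by norm_num)]; norm_num
  have hA := Real.rpow_nonneg ha0 (p - 2)
  have hB := Real.rpow_nonneg hb0 p
  have rest : 0 ≤ p / 2 * (4 * (p / 2 - 1) * (9 / 4) ^ (p / 2 - 1)) * (25 / 4) := by positivity
  -- If `d` is not small compared with `z`, every term is dominated by `‖d‖ ^ p`. Otherwise the
  -- ratio `‖z + d‖² / ‖z‖²` lies in `[1/4, 9/4]` and the scalar expansion applies to its power `p /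
  -- 2`.
  rcases le_or_gt a (2 * b) with hab | hab
  · have h1 : ‖z + d‖ ^ p ≤ 3 ^ p * b ^ p := by
      rw [← Real.mul_rpow (by norm_num) hb0]
      refine Real.rpow_le_rpow (norm_nonneg _) ?_ (by linarith)
      have := norm_add_le z d
      linarith
    have h2 : -(p * 2 ^ (p - 1) * b ^ p) ≤ p * (a ^ (p - 2) * inner ℝ z d) := by
      have h3 : a ^ (p - 2) * |inner ℝ z d| ≤ 2 ^ (p - 1) * b ^ p := by
        calc a ^ (p - 2) * |inner ℝ z d| ≤ (2 * b) ^ (p - 2) * ((2 * b) * b) := by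
              gcongr
              exact inner_le.trans (by gcongr)
          _ = 2 ^ (p - 1) * b ^ p := by
              rw [Real.mul_rpow (by norm_num) hb0, split b hb0,
                show p - 1 = (p - 2) + 1 by ring, Real.rpow_add (by norm_num), Real.rpow_one]
              ring
      have h4 := neg_abs_le (inner ℝ z d)
      have h5 : -(2 ^ (p - 1) * b ^ p) ≤ a ^ (p - 2) * inner ℝ z d := by nlinarith
      nlinarith
    have h6 : (3 ^ p + p * 2 ^ (p - 1)) * b ^ p
        ≤ expansionConst p * (a ^ (p - 2) * b ^ 2 + b ^ p) := by
      have h7 : (3 : ℝ) ^ p + p * 2 ^ (p - 1) ≤ expansionConst p := by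
        unfold expansionConst; linarith
      have h8 : 0 ≤ a ^ (p - 2) * b ^ 2 := by positivity
      have h9 : (0 : ℝ) ≤ 3 ^ p + p * 2 ^ (p - 1) := by positivity
      exact mul_le_mul h7 (by linarith) hB (h9.trans h7)
    have := Real.rpow_nonneg ha0 p
    linarith
  · have hapos : 0 < a := by linarith
    have hsq : ‖z + d‖ ^ 2 = a ^ 2 + 2 * inner ℝ z d + b ^ 2 := norm_add_sq_real z d
    set i : ℝ := inner ℝ z d
    have hi := abs_le.1 inner_le
    set y := ‖z + d‖ ^ 2 / a ^ 2 with hy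
    have hya : y * a ^ 2 = a ^ 2 + 2 * i + b ^ 2 := by
      rw [hy, ← hsq]; field_simp
    have lower : a / 2 ≤ ‖z + d‖ := by
      have : a ≤ ‖z + d‖ + b := by
        have := norm_sub_le (z + d) d
        rwa [add_sub_cancel_right] at this
      linarith
    have upper : ‖z + d‖ ≤ 3 / 2 * a := by
      have := norm_add_le z d
      linarith
    have hy₁ : 1 / 4 ≤ y := by
      rw [hy, le_div_iff₀ (by positivity)]; nlinarith
    have hy₂ : y ≤ 9 / 4 := by
      rw [hy, div_le_iff₀ (by positivity)]; nlinarith [norm_nonneg (z + d)]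
    have key := rpow_le_quadratic hr hy₁ hy₂
    rw [sub_add_cancel] at key
    have hz : ‖z + d‖ ^ p = a ^ p * y ^ (p / 2) := by
      have e : ∀ x : ℝ, 0 ≤ x → x ^ p = (x ^ 2) ^ (p / 2) := fun x hx => by
        rw [← Real.rpow_natCast x 2, ← Real.rpow_mul hx]; congr 1; push_cast; ring
      rw [e _ (norm_nonneg _), e a ha0, ← Real.mul_rpow (by positivity) (by positivity)]
      congr 1
      rw [hy]; field_simp
    have hap := split a ha0
    set α := a ^ (p - 2)
    have hy3 : a ^ 2 * (y - 1) = 2 * i + b ^ 2 := by linarith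
    have hy4 : a ^ 2 * (y - 1) ^ 2 ≤ 25 / 4 * b ^ 2 := by
      have : a ^ 2 * (a ^ 2 * (y - 1) ^ 2) ≤ a ^ 2 * (25 / 4 * b ^ 2) := by
        have e : a ^ 2 * (a ^ 2 * (y - 1) ^ 2) = (2 * i + b ^ 2) ^ 2 := by rw [← hy3]; ring
        rw [e]
        have h1 : |2 * i + b ^ 2| ≤ 5 / 2 * (a * b) := by
          rw [abs_le]; constructor <;> nlinarith
        calc (2 * i + b ^ 2) ^ 2 ≤ (5 / 2 * (a * b)) ^ 2 := sq_le_sq' (by linarith [(abs_le.1 h1).1]) (abs_le.1 h1).2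
          _ = _ := by ring
      exact le_of_mul_le_mul_left this (by positivity)
    set D := 4 * (p / 2 - 1) * (9 / 4 : ℝ) ^ (p / 2 - 1) with hD
    have hD0 : 0 ≤ D := by positivity
    rw [hz, hap]
    calc α * a ^ 2 * y ^ (p / 2)
        ≤ α * a ^ 2 * (1 + p / 2 * (y - 1) + p / 2 * D * (y - 1) ^ 2) := by gcongr
      _ = α * a ^ 2 + α * (p / 2) * (a ^ 2 * (y - 1)) + α * (p / 2 * D) * (a ^ 2 * (y - 1) ^ 2) := by
          ring
      _ ≤ α * a ^ 2 + α * (p / 2) * (2 * i + b ^ 2) + α * (p / 2 * D) * (25 / 4 * b ^ 2) := by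
          rw [hy3]
          gcongr
      _ = α * a ^ 2 + p * (α * i) + (p / 2 + p / 2 * D * (25 / 4)) * (α * b ^ 2) := by ring
      _ ≤ α * a ^ 2 + p * (α * i) + expansionConst p * (α * b ^ 2 + b ^ p) := by
          have h7 : p / 2 + p / 2 * D * (25 / 4) ≤ expansionConst p := by
            rw [expansionConst, ← hD]
            have : (0 : ℝ) ≤ 3 ^ p + p * 2 ^ (p - 1) := by positivity
            linarith
          have h9 : 0 ≤ p / 2 + p / 2 * D * (25 / 4) := by positivity
          have : (p / 2 + p / 2 * D * (25 / 4)) * (α * b ^ 2)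
              ≤ expansionConst p * (α * b ^ 2 + b ^ p) :=
            mul_le_mul h7 (by linarith) (by positivity) (h9.trans h7)
          linarith

/-- Comparison of a Taylor type bound with a power of a sum. -/
lemma sq_le_of_rpow_le {p x a b c : ℝ} (hp : 2 ≤ p) (hx : 0 ≤ x) (ha : 0 ≤ a) (hb : 0 ≤ b)
    (hc : 1 ≤ c) (h : x ^ p ≤ a ^ p + c * (a ^ (p - 2) * b ^ 2 + b ^ p)) :
    x ^ 2 ≤ a ^ 2 + 2 * c * b ^ 2 := by
  have e : ∀ x : ℝ, 0 ≤ x → x ^ p = (x ^ 2) ^ (p / 2) := fun x hx => by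
    rw [← Real.rpow_natCast x 2, ← Real.rpow_mul hx]; congr 1; push_cast; ring
  have e' : a ^ (p - 2) = (a ^ 2) ^ (p / 2 - 1) := by
    rw [← Real.rpow_natCast a 2, ← Real.rpow_mul ha]; congr 1; push_cast; ring
  rw [e x hx, e a ha, e b hb, e'] at h
  have hq : 1 ≤ p / 2 := by linarith
  set q := p / 2
  have hA : 0 ≤ a ^ 2 := by positivity
  have hB : 0 ≤ b ^ 2 := by positivity
  set A := a ^ 2
  set B := b ^ 2
  refine (Real.rpow_le_rpow_iff (sq_nonneg x) (by positivity) (by linarith : 0 < q)).1 (h.trans ?_)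
  -- The target dominates both `A ^ q + (2cB) ^ q` (superadditivity) and `A ^ q + q A ^ (q - 1) 2cB`
  -- (Bernoulli). Averaging the two yields both remainder terms; this is the origin of the factor
  -- `2` in `2 * c`.
  have h1 : A ^ q + (2 * c * B) ^ q ≤ (A + 2 * c * B) ^ q :=
    Real.add_rpow_le_rpow_add hA (by positivity) hq
  have h2 : A ^ q + q * A ^ (q - 1) * (2 * c * B) ≤ (A + 2 * c * B) ^ q := by
    rcases hA.eq_or_lt with hA0 | hA0
    · rw [← hA0, Real.zero_rpow (by linarith), zero_add, zero_add]
      rcases hq.eq_or_lt with hq1 | hq1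
      · rw [← hq1]; simp
      · rw [Real.zero_rpow (by linarith)]; simp; positivity
    · have h := one_add_mul_self_le_rpow_one_add (s := 2 * c * B / A) (p := q)
        (by have : 0 ≤ 2 * c * B / A := by positivity
            linarith) hq
      have h' := mul_le_mul_of_nonneg_left h (Real.rpow_nonneg hA q)
      rw [← Real.mul_rpow hA (by positivity)] at h'
      have e1 : A * (1 + 2 * c * B / A) = A + 2 * c * B := by field_simp
      have e2 : A ^ q = A ^ (q - 1) * A := by
        rw [← Real.rpow_add_one hA0.ne']; ring_nf
      rw [e1] at h'
      calc _ = A ^ q * (1 + q * (2 * c * B / A)) := by rw [e2]; field_simp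
        _ ≤ _ := h'
  have h3 : 2 * c * B ^ q ≤ (2 * c * B) ^ q := by
    rw [Real.mul_rpow (by positivity) hB]
    gcongr
    exact Real.self_le_rpow_of_one_le (by linarith) hq
  have h4 : 2 * c * (A ^ (q - 1) * B) ≤ q * A ^ (q - 1) * (2 * c * B) := by
    have : 0 ≤ 2 * c * (A ^ (q - 1) * B) := by positivity
    nlinarith
  linarith

end Smoothness

/-! ### One-step square function inequality in `L^p` -/

section Martingale

variable {H : Type*} [NormedAddCommGroup H] [InnerProductSpace ℝ H] [CompleteSpace H]
  {Ω : Type*} {m mΩ : MeasurableSpace Ω} {P : Measure Ω}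

lemma integral_norm_rpow_eq {p : ℝ≥0} (hp : 2 ≤ p) {X : Ω → H} (hX : MemLp X p P) :
    ∫ ω, ‖X ω‖ ^ (p : ℝ) ∂P = (eLpNorm X p P).toReal ^ (p : ℝ) := by
  have hp0 : p ≠ 0 := by rintro rfl; norm_num at hp
  rw [hX.eLpNorm_eq_integral_rpow_norm (by exact_mod_cast hp0) (by simp), ENNReal.coe_toReal,
    ENNReal.toReal_ofReal (by positivity), ← Real.rpow_mul (by positivity), inv_mul_cancel₀
    (by exact_mod_cast hp0), Real.rpow_one]

/-- Hölder's inequality with weights `(p - 2) / p` and `2 / p`; the first weight may be zero, so `p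
= 2` is covered. -/
lemma integral_norm_rpow_mul_sq_le {p : ℝ≥0} (hp : 2 ≤ p) {Z D : Ω → H} (hZ : MemLp Z p P)
    (hD : MemLp D p P) :
    ∫ ω, ‖Z ω‖ ^ ((p : ℝ) - 2) * ‖D ω‖ ^ 2 ∂P
      ≤ (eLpNorm Z p P).toReal ^ ((p : ℝ) - 2) * (eLpNorm D p P).toReal ^ 2 := by
  have hp0 : p ≠ 0 := by rintro rfl; norm_num at hp
  have hp0' : (0 : ℝ) < p := by positivity
  have hp2 : (2 : ℝ) ≤ p := by exact_mod_cast hp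
  have e : ∀ X : Ω → H, eLpNorm X p P = (∫⁻ ω, ‖X ω‖ₑ ^ (p : ℝ) ∂P) ^ (1 / (p : ℝ)) := fun X => by
    rw [eLpNorm_eq_lintegral_rpow_enorm_toReal (by exact_mod_cast hp0) (by simp),
      ENNReal.coe_toReal]
  have holder := ENNReal.lintegral_mul_norm_pow_le (μ := P) (f := fun ω => ‖Z ω‖ₑ ^ (p : ℝ))
    (g := fun ω => ‖D ω‖ₑ ^ (p : ℝ)) (hZ.1.enorm.pow_const _) (hD.1.enorm.pow_const _)
    (p := ((p : ℝ) - 2) / p) (q := 2 / p) (by apply div_nonneg <;> linarith) (by positivity)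
    (by field_simp; ring)
  have hZ' := e Z
  have hD' := e D
  have eZ : (∫⁻ ω, ‖Z ω‖ₑ ^ (p : ℝ) ∂P) ^ (((p : ℝ) - 2) / p)
      = eLpNorm Z p P ^ ((p : ℝ) - 2) := by
    rw [hZ', ← ENNReal.rpow_mul]; congr 1; field_simp
  have eD : (∫⁻ ω, ‖D ω‖ₑ ^ (p : ℝ) ∂P) ^ (2 / (p : ℝ)) = eLpNorm D p P ^ (2 : ℝ) := by
    rw [hD', ← ENNReal.rpow_mul]; congr 1; field_simp
  rw [eZ, eD] at holder
  rw [integral_eq_lintegral_of_nonneg_ae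
    (f := fun ω => ‖Z ω‖ ^ ((p : ℝ) - 2) * ‖D ω‖ ^ 2) (Eventually.of_forall fun ω => by positivity)
    ((hZ.1.norm.aemeasurable.pow_const _).mul
      (hD.1.norm.aemeasurable.pow_const _)).aestronglyMeasurable]
  have fin : eLpNorm Z p P ^ ((p : ℝ) - 2) * eLpNorm D p P ^ (2 : ℝ) ≠ ∞ :=
    ENNReal.mul_ne_top (ENNReal.rpow_ne_top_of_nonneg (by linarith) hZ.2.ne)
      (ENNReal.rpow_ne_top_of_nonneg (by norm_num) hD.2.ne)
  have := ENNReal.toReal_mono fin holder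
  rw [ENNReal.toReal_mul, ← ENNReal.toReal_rpow, ← ENNReal.toReal_rpow, Real.rpow_two] at this
  refine le_trans (le_of_eq ?_) this
  congr 1
  refine lintegral_congr fun ω => ?_
  rw [← ENNReal.rpow_mul, ← ENNReal.rpow_mul, mul_div_cancel₀ _ hp0'.ne',
    mul_div_cancel₀ _ hp0'.ne', ENNReal.ofReal_mul (by positivity),
    ← ENNReal.ofReal_rpow_of_nonneg (norm_nonneg _) (by linarith), ENNReal.ofReal_pow (norm_nonneg _),
    ofReal_norm, ofReal_norm, ENNReal.rpow_two]

/-- Integrating the expansion of `‖Z + D‖ ^ p` removes the linear term, because `D` is orthogonal to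
everything `m`-measurable. Returning to squares gives a bound that is additive over successive
steps. -/
lemma eLpNorm_add_sq_le_of_condExp_eq_zero [IsProbabilityMeasure P] (hm : m ≤ mΩ) {p : ℝ≥0}
    (hp : 2 ≤ p) {Z D : Ω → H} (hZm : StronglyMeasurable[m] Z) (hZ : MemLp Z p P)
    (hD : MemLp D p P) (hD0 : P[D | m] =ᵐ[P] 0) :
    (eLpNorm (Z + D) p P).toReal ^ 2 ≤ (eLpNorm Z p P).toReal ^ 2
      + 2 * expansionConst p * (eLpNorm D p P).toReal ^ 2 := by
  have hp2 : (2 : ℝ) ≤ p := by exact_mod_cast hp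
  have hp0 : p ≠ 0 := by rintro rfl; norm_num at hp
  have int : ∀ {X : Ω → H}, MemLp X p P → Integrable (fun ω => ‖X ω‖ ^ (p : ℝ)) P := fun hX => by
    simpa using hX.integrable_norm_rpow (by exact_mod_cast hp0) (by simp)
  have split : ∀ x : ℝ, 0 ≤ x → x ^ (p : ℝ) = x ^ ((p : ℝ) - 2) * x ^ 2 := fun x hx => by
    rw [← Real.rpow_natCast x 2, ← Real.rpow_add_of_nonneg hx (by linarith) (by norm_num)]; norm_num
  -- A crude majorant by `p`-th powers, needed only for the integrability of the two mixed terms.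
  have prod_le : ∀ x y : ℝ, 0 ≤ x → 0 ≤ y → ∀ k l : ℝ, 0 ≤ k → 0 ≤ l → k ≤ x + y → l ≤ x + y →
      x ^ ((p : ℝ) - 2) * (k * l) ≤ 2 ^ (p : ℝ) * x ^ (p : ℝ) + 2 ^ (p : ℝ) * y ^ (p : ℝ) := by
    intro x y hx hy k l hk hl hkx hlx
    have h0 : x ^ ((p : ℝ) - 2) * (k * l) ≤ (2 * max x y) ^ (p : ℝ) := by
      have hmax : x + y ≤ 2 * max x y := by
        have := le_max_left x y
        have := le_max_right x y
        linarith
      rw [split _ (by positivity)]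
      have h2 : x ^ ((p : ℝ) - 2) ≤ (2 * max x y) ^ ((p : ℝ) - 2) :=
        Real.rpow_le_rpow hx (by linarith) (by linarith)
      have h3 : k * l ≤ (2 * max x y) ^ 2 := by
        rw [sq]; exact mul_le_mul (hkx.trans hmax) (hlx.trans hmax) hl (by positivity)
      exact mul_le_mul h2 h3 (by positivity) (by positivity)
    rw [Real.mul_rpow (by norm_num) (by positivity)] at h0
    have h1 : max x y ^ (p : ℝ) ≤ x ^ (p : ℝ) + y ^ (p : ℝ) := by
      have := Real.rpow_nonneg hx (p : ℝ)
      have := Real.rpow_nonneg hy (p : ℝ)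
      rcases max_cases x y with ⟨h, _⟩ | ⟨h, _⟩ <;> rw [h] <;> linarith
    have h4 : (0 : ℝ) ≤ 2 ^ (p : ℝ) := by positivity
    nlinarith
  have bound_int : Integrable
      (fun ω => 2 ^ (p : ℝ) * ‖Z ω‖ ^ (p : ℝ) + 2 ^ (p : ℝ) * ‖D ω‖ ^ (p : ℝ)) P :=
    ((int hZ).const_mul _).add ((int hD).const_mul _)
  have int_inner : Integrable (fun ω => ‖Z ω‖ ^ ((p : ℝ) - 2) * inner ℝ (Z ω) (D ω)) P := by
    refine bound_int.mono' (((hZ.1.norm.aemeasurable.pow_const _)).aestronglyMeasurable.mul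
      (hZ.1.inner hD.1)) (Eventually.of_forall fun ω => ?_)
    rw [norm_mul, Real.norm_of_nonneg (by positivity)]
    refine le_trans ?_ (prod_le ‖Z ω‖ ‖D ω‖ (norm_nonneg _) (norm_nonneg _) ‖Z ω‖ ‖D ω‖
      (norm_nonneg _) (norm_nonneg _) (by simp) (by simp))
    gcongr
    exact norm_inner_le_norm _ _
  have int_sq : Integrable (fun ω => ‖Z ω‖ ^ ((p : ℝ) - 2) * ‖D ω‖ ^ 2) P := by
    refine bound_int.mono' ((hZ.1.norm.aemeasurable.pow_const _).mul
      (hD.1.norm.aemeasurable.pow_const _)).aestronglyMeasurable (Eventually.of_forall fun ω => ?_)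
    rw [Real.norm_of_nonneg (by positivity), sq]
    exact prod_le ‖Z ω‖ ‖D ω‖ (norm_nonneg _) (norm_nonneg _) ‖D ω‖ ‖D ω‖
      (norm_nonneg _) (norm_nonneg _) (by simp) (by simp)
  -- The weight `‖Z‖ ^ (p - 2) • Z` is `m`-measurable, so it can be pulled out of the conditional
  -- expectation.
  have zero : ∫ ω, ‖Z ω‖ ^ ((p : ℝ) - 2) * inner ℝ (Z ω) (D ω) ∂P = 0 := by
    have hWm : StronglyMeasurable[m] (fun ω => ‖Z ω‖ ^ ((p : ℝ) - 2) • Z ω) :=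
      ((hZm.norm.measurable.pow_const _).stronglyMeasurable).smul hZm
    have e : (fun ω => ‖Z ω‖ ^ ((p : ℝ) - 2) * inner ℝ (Z ω) (D ω))
        = fun ω => innerSL ℝ (‖Z ω‖ ^ ((p : ℝ) - 2) • Z ω) (D ω) := by
      funext ω; simp
    rw [e] at int_inner ⊢
    have pull := condExp_bilin_of_stronglyMeasurable_left (innerSL ℝ) hWm int_inner
      (hD.integrable (by exact_mod_cast (one_le_two.trans hp)))
    rw [← integral_condExp hm, integral_congr_ae pull]
    refine integral_eq_zero_of_ae ?_
    filter_upwards [hD0] with ω hω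
    rw [hω]; simp
  refine sq_le_of_rpow_le hp2 ENNReal.toReal_nonneg ENNReal.toReal_nonneg ENNReal.toReal_nonneg
    (one_le_expansionConst hp2) ?_
  rw [← integral_norm_rpow_eq hp (hZ.add hD), ← integral_norm_rpow_eq hp hZ,
    ← integral_norm_rpow_eq hp hD]
  have mono : ∫ ω, ‖(Z + D) ω‖ ^ (p : ℝ) ∂P ≤ ∫ ω, (‖Z ω‖ ^ (p : ℝ)
      + (p : ℝ) * (‖Z ω‖ ^ ((p : ℝ) - 2) * inner ℝ (Z ω) (D ω))
      + expansionConst p * (‖Z ω‖ ^ ((p : ℝ) - 2) * ‖D ω‖ ^ 2 + ‖D ω‖ ^ (p : ℝ))) ∂P :=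
    integral_mono (int (hZ.add hD)) (((int hZ).add (int_inner.const_mul _)).add
      ((int_sq.add (int hD)).const_mul _)) fun ω => norm_add_rpow_le hp2 _ _
  rw [integral_add (f := fun ω => ‖Z ω‖ ^ (p : ℝ)
      + (p : ℝ) * (‖Z ω‖ ^ ((p : ℝ) - 2) * inner ℝ (Z ω) (D ω)))
      (g := fun ω => expansionConst p * (‖Z ω‖ ^ ((p : ℝ) - 2) * ‖D ω‖ ^ 2 + ‖D ω‖ ^ (p : ℝ)))
      ((int hZ).add (int_inner.const_mul _)) ((int_sq.add (int hD)).const_mul _),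
    integral_add (int hZ) (int_inner.const_mul _), integral_const_mul, zero, mul_zero, add_zero,
    integral_const_mul, integral_add int_sq (int hD)] at mono
  refine mono.trans ?_
  have := integral_norm_rpow_mul_sq_le hp hZ hD
  have hc := one_le_expansionConst hp2
  gcongr

/-- The square function estimate for one increment `Δ`, split into its conditional mean and its
martingale part. -/
lemma eLpNorm_add_increment_sq_le [IsProbabilityMeasure P] (hm : m ≤ mΩ) {p : ℝ≥0}
    (hp : 2 ≤ p) {Z Δ : Ω → H} (hZm : StronglyMeasurable[m] Z) (hZ : MemLp Z p P)
    (hΔ : MemLp Δ p P) {M V : ℝ} (hfin : eLpNorm (P[Δ | m]) p P ≠ ∞)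
    (hM : (eLpNorm (P[Δ | m]) p P).toReal ≤ M)
    (hV : (eLpNorm (Δ - P[Δ | m]) p P).toReal ≤ V) :
    (eLpNorm (Z + Δ) p P).toReal ^ 2 ≤ ((eLpNorm Z p P).toReal + M) ^ 2
      + 2 * expansionConst p * V ^ 2 := by
  have hp2 : (2 : ℝ) ≤ p := by exact_mod_cast hp
  have hp1 : (1 : ℝ≥0∞) ≤ p := by exact_mod_cast (one_le_two.trans hp)
  have int : Integrable Δ P := hΔ.integrable hp1
  have hE : MemLp (P[Δ | m]) p P :=
    ⟨(stronglyMeasurable_condExp.mono hm).aestronglyMeasurable, hfin.lt_top⟩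
  have h0 : P[Δ - P[Δ | m] | m] =ᵐ[P] 0 := by
    have h1 := condExp_sub int (integrable_condExp (m := m) (f := Δ)) m (μ := P)
    have h2 := condExp_condExp_of_le (f := Δ) (μ := P) le_rfl hm
    filter_upwards [h1, h2] with ω h1 h2
    rw [h1]; simp [h2]
  -- The conditional mean is `m`-measurable, so it is grouped with `Z`, where the triangle
  -- inequality suffices; only the centred remainder is treated as a martingale increment.
  have key := eLpNorm_add_sq_le_of_condExp_eq_zero hm hp
    (hZm.add (stronglyMeasurable_condExp (f := Δ) (μ := P))) (hZ.add hE) (hΔ.sub hE) h0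
  have e : Z + P[Δ | m] + (Δ - P[Δ | m]) = Z + Δ := by abel
  rw [e] at key
  refine key.trans ?_
  have hc := one_le_expansionConst hp2
  have tri : (eLpNorm (Z + P[Δ | m]) p P).toReal ≤ (eLpNorm Z p P).toReal + M := by
    have := ENNReal.toReal_mono (ENNReal.add_ne_top.2 ⟨hZ.2.ne, hfin⟩) (eLpNorm_add_le hZ.1 hE.1 hp1)
    rw [ENNReal.toReal_add hZ.2.ne hfin] at this
    linarith
  have h1 : (0 : ℝ) ≤ expansionConst p := by linarith
  gcongr

end Martingale

/-! ### Gluing couplings into the law of a sequence -/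

section Chaining

open ProbabilityTheory

variable {E : Type*} [MeasurableSpace E] [StandardBorelSpace E] [Nonempty E]

/-- Couplings with matching consecutive marginals can be glued into the law of a sequence. -/
lemma exists_measure_of_consecutive_couplings (Q : ℕ → Measure (E × E))
    [∀ n, IsProbabilityMeasure (Q n)]
    (h : ∀ n, (Q n).map Prod.snd = (Q (n + 1)).map Prod.fst) :
    ∃ R : Measure (ℕ → E), IsProbabilityMeasure R ∧
      ∀ n, R.map (fun x => (x n, x (n + 1))) = Q n := by
  -- A Markov chain: the next point is drawn from the disintegration of `Q n`, which sees only the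
  -- last coordinate of the past.
  let κ : (n : ℕ) → Kernel ((i : Finset.Iic n) → E) E := fun n =>
    (Q n).condKernel.comap (fun x => x ⟨n, Finset.mem_Iic.2 le_rfl⟩) (by fun_prop)
  have : IsProbabilityMeasure ((Q 0).map Prod.fst) :=
    Measure.isProbabilityMeasure_map measurable_fst.aemeasurable
  let R := Kernel.trajMeasure (X := fun _ => E) ((Q 0).map Prod.fst) κ
  have step : ∀ n, R.map (fun x => x n) = (Q n).map Prod.fst →
      R.map (fun x => (x n, x (n + 1))) = Q n := by
    intro n hn
    have key := Kernel.map_frestrictLe_trajMeasure_compProd_eq_map_trajMeasure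
      (X := fun _ => E) (μ₀ := (Q 0).map Prod.fst) (κ := κ) (a := n)
    have e : R.map (fun x => (x n, x (n + 1)))
        = (R.map (fun x => (Preorder.frestrictLe n x, x (n + 1)))).map
          (Prod.map (fun x => x ⟨n, Finset.mem_Iic.2 le_rfl⟩) id) := by
      rw [Measure.map_map (by fun_prop) (by fun_prop)]; rfl
    rw [e, ← key]
    conv_rhs => rw [← (Q n).disintegrate (Q n).condKernel, Measure.fst, ← hn]
    have e2 : R.map (fun x => x n) = (R.map (Preorder.frestrictLe n)).map
        (fun x => x ⟨n, Finset.mem_Iic.2 le_rfl⟩) := by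
      rw [Measure.map_map (by fun_prop) (by fun_prop)]; rfl
    rw [e2]
    ext s hs
    have hm : Measurable (Prod.map (fun x : (i : Finset.Iic n) → E =>
      x ⟨n, Finset.mem_Iic.2 le_rfl⟩) (id : E → E)) := by fun_prop
    have := Measure.isProbabilityMeasure_map (μ := R)
      (Preorder.measurable_frestrictLe (X := fun _ => E) n).aemeasurable
    rw [Measure.map_apply hm hs, Measure.compProd_apply (hm hs), Measure.compProd_apply hs,
      lintegral_map (Kernel.measurable_kernel_prodMk_left hs) (by fun_prop)]
    rfl
  refine ⟨R, inferInstance, fun n => step n ?_⟩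
  induction n with
  | zero =>
    have e : R.map (fun x => x 0) = (Q 0).map Prod.fst := by
      have e1 : R.map (fun x => x 0) = (R.map (Preorder.frestrictLe 0)).map
          (fun x => x ⟨0, Finset.mem_Iic.2 le_rfl⟩) := by
        rw [Measure.map_map (by fun_prop) (by fun_prop)]; rfl
      simp only [R, Kernel.trajMeasure] at e1 ⊢
      rw [e1, Measure.map_comp _ _ (by fun_prop),
        Kernel.traj_map_frestrictLe, Kernel.partialTraj_self, Measure.id_comp,
        Measure.map_map (by fun_prop) (by fun_prop)]
      exact Measure.map_id
    exact e
  | succ n ih =>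
    have h1 := step n ih
    rw [← h, ← h1, Measure.map_map (by fun_prop) (by fun_prop)]
    rfl

end Chaining

/-! ### The Wasserstein metric and its completeness -/

section WassersteinSpace

variable {H : Type u} [NormedAddCommGroup H] [TopologicalSpace.SeparableSpace H]
  [CompleteSpace H] [MeasurableSpace H] [BorelSpace H] {p : ℝ≥0}

lemma isProbabilityMeasure_of_mem_couplings {μ ν : PMoment H p} {Q : Measure (H × H)}
    (hQ : Q ∈ couplings μ ν) : IsProbabilityMeasure Q := by
  have := μ.2.1
  constructor
  rw [← Set.preimage_univ (f := Prod.fst), ← Measure.map_apply measurable_fst .univ, hQ.1,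
    measure_univ]

lemma wasserstein_le_of_map {Ω : Type*} {mΩ : MeasurableSpace Ω} {P : Measure Ω} {X Y : Ω → H}
    (hX : Measurable X) (hY : Measurable Y) {μ ν : PMoment H p} (hμ : P.map X = μ.1)
    (hν : P.map Y = ν.1) : wasserstein μ ν ≤ eLpNorm (X - Y) p P := by
  have := UniformSpace.secondCountable_of_separable H
  have hmem : (P.map fun ω => (X ω, Y ω)) ∈ couplings μ ν := by
    refine ⟨?_, ?_⟩
    · rw [Measure.map_map measurable_fst (hX.prodMk hY), ← hμ]; rfl
    · rw [Measure.map_map measurable_snd (hX.prodMk hY), ← hν]; rfl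
  refine (iInf₂_le (P.map fun ω => (X ω, Y ω)) hmem).trans (le_of_eq ?_)
  · rw [eLpNorm_map_measure (by fun_prop) (hX.prodMk hY).aemeasurable]; rfl

lemma eLpNorm_eq_moment {Ω : Type*} {mΩ : MeasurableSpace Ω} {P : Measure Ω} {X : Ω → H}
    (hX : Measurable X) {μ : PMoment H p} (hμ : P.map X = μ.1) : eLpNorm X p P = moment μ := by
  have := UniformSpace.secondCountable_of_separable H
  rw [moment, ← hμ, eLpNorm_map_measure (by fun_prop) hX.aemeasurable]; rfl

lemma exists_coupling_lt {μ ν : PMoment H p} {c : ℝ≥0∞} (h : wasserstein μ ν < c) :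
    ∃ Q ∈ couplings μ ν, eLpNorm (fun z : H × H => z.1 - z.2) p Q < c := by
  simpa [wasserstein, iInf_lt_iff] using h

lemma moment_lt_top (μ : PMoment H p) : moment μ < ∞ := μ.2.2

lemma wasserstein_self (μ : PMoment H p) : wasserstein μ μ = 0 := by
  refine le_antisymm ((wasserstein_le_of_map measurable_id measurable_id (P := μ.1)
    (Measure.map_id) (Measure.map_id)).trans ?_) zero_le
  simp

lemma wasserstein_comm_le (μ ν : PMoment H p) : wasserstein μ ν ≤ wasserstein ν μ := by
  have := UniformSpace.secondCountable_of_separable H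
  refine le_iInf₂ fun Q hQ => ?_
  refine (wasserstein_le_of_map measurable_snd measurable_fst hQ.2 hQ.1).trans (le_of_eq ?_)
  rw [← eLpNorm_neg]
  congr 1
  funext z
  simp

lemma wasserstein_comm (μ ν : PMoment H p) : wasserstein μ ν = wasserstein ν μ :=
  le_antisymm (wasserstein_comm_le _ _) (wasserstein_comm_le _ _)

/-- Glueing of a sequence of couplings, on the space of sequences. -/
lemma exists_sequence_of_couplings (μ : ℕ → PMoment H p) (Q : ℕ → Measure (H × H))
    (hQ : ∀ n, Q n ∈ couplings (μ n) (μ (n + 1))) :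
    ∃ R : Measure (ℕ → H), IsProbabilityMeasure R ∧ (∀ n, R.map (fun x => x n) = (μ n).1) ∧
      ∀ n, eLpNorm (fun x : ℕ → H => x n - x (n + 1)) p R
        = eLpNorm (fun z : H × H => z.1 - z.2) p (Q n) := by
  have := UniformSpace.secondCountable_of_separable H
  have : ∀ n, IsProbabilityMeasure (Q n) := fun n => isProbabilityMeasure_of_mem_couplings (hQ n)
  obtain ⟨R, hR, h⟩ := exists_measure_of_consecutive_couplings Q
    (fun n => (hQ n).2.trans (hQ (n + 1)).1.symm)
  refine ⟨R, hR, fun n => ?_, fun n => ?_⟩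
  · rw [← (hQ n).1, ← h n, Measure.map_map measurable_fst (by fun_prop)]; rfl
  · rw [← h n, eLpNorm_map_measure (by fun_prop) (by fun_prop)]; rfl

lemma wasserstein_triangle (hp : 1 ≤ p) (μ₀ μ₁ μ₂ : PMoment H p) :
    wasserstein μ₀ μ₂ ≤ wasserstein μ₀ μ₁ + wasserstein μ₁ μ₂ := by
  have := UniformSpace.secondCountable_of_separable H
  refine ENNReal.le_of_forall_pos_le_add fun ε hε hfin => ?_
  have hε2 : (0 : ℝ≥0∞) < (ε : ℝ≥0∞) / 2 := by simpa using hε.ne'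
  rw [ENNReal.add_lt_top] at hfin
  obtain ⟨Q₀, hQ₀, h₀⟩ := exists_coupling_lt (ENNReal.lt_add_right hfin.1.ne hε2.ne')
  obtain ⟨Q₁, hQ₁, h₁⟩ := exists_coupling_lt (ENNReal.lt_add_right hfin.2.ne hε2.ne')
  -- Gluing is available for infinite sequences, so the three measures are continued by `μ₂` with
  -- diagonal couplings.
  let μ : ℕ → PMoment H p := fun | 0 => μ₀ | 1 => μ₁ | _ + 2 => μ₂
  let Q : ℕ → Measure (H × H) := fun
    | 0 => Q₀
    | 1 => Q₁
    | _ + 2 => μ₂.1.map fun x => (x, x)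
  obtain ⟨R, hR, hmarg, hdist⟩ := exists_sequence_of_couplings μ Q (fun n => by
    match n with
    | 0 => exact hQ₀
    | 1 => exact hQ₁
    | n + 2 =>
      refine ⟨?_, ?_⟩ <;>
      simp only [Q, μ] <;> rw [Measure.map_map (by fun_prop) (by fun_prop)] <;> exact Measure.map_id)
  calc wasserstein μ₀ μ₂ ≤ eLpNorm ((fun x : ℕ → H => x 0) - fun x => x 2) p R :=
        wasserstein_le_of_map (by fun_prop) (by fun_prop) (hmarg 0) (hmarg 2)
    _ = eLpNorm ((fun x : ℕ → H => x 0 - x 1) + fun x => x 1 - x 2) p R := by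
        congr 1; funext x; simp
    _ ≤ eLpNorm (fun x : ℕ → H => x 0 - x 1) p R + eLpNorm (fun x : ℕ → H => x 1 - x 2) p R :=
        eLpNorm_add_le (by fun_prop) (by fun_prop) (by exact_mod_cast hp)
    _ ≤ (wasserstein μ₀ μ₁ + ε / 2) + (wasserstein μ₁ μ₂ + ε / 2) := by
        rw [hdist 0, hdist 1]
        exact add_le_add h₀.le h₁.le
    _ = wasserstein μ₀ μ₁ + wasserstein μ₁ μ₂ + ε := by
        rw [add_add_add_comm, ENNReal.add_halves]

lemma moment_le_add_wasserstein (hp : 1 ≤ p) (μ ν : PMoment H p) :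
    moment μ ≤ moment ν + wasserstein μ ν := by
  have := UniformSpace.secondCountable_of_separable H
  refine ENNReal.le_of_forall_pos_le_add fun ε hε hfin => ?_
  rw [ENNReal.add_lt_top] at hfin
  obtain ⟨Q, hQ, hlt⟩ := exists_coupling_lt
    (ENNReal.lt_add_right hfin.2.ne (ENNReal.coe_ne_zero.2 hε.ne'))
  rw [← eLpNorm_eq_moment measurable_fst hQ.1, ← eLpNorm_eq_moment measurable_snd hQ.2, add_assoc]
  calc eLpNorm Prod.fst p Q = eLpNorm (Prod.snd + fun z : H × H => z.1 - z.2) p Q := by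
        congr 1; funext z; simp
    _ ≤ _ := eLpNorm_add_le (by fun_prop) (by fun_prop) (by exact_mod_cast hp)
    _ ≤ _ := by gcongr

/-- Measures at Wasserstein distance zero are equal. -/
lemma eq_of_wasserstein_eq_zero (hp : 1 ≤ p) {μ ν : PMoment H p} (h : wasserstein μ ν = 0) :
    μ = ν := by
  have := UniformSpace.secondCountable_of_separable H
  have := μ.2.1
  have := ν.2.1
  have hp0 : (p : ℝ≥0∞) ≠ 0 := by
    have : p ≠ 0 := by rintro rfl; norm_num at hp
    exact_mod_cast this
  have hLP : levyProkhorovEDist μ.1 ν.1 = 0 := by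
    refine le_antisymm (levyProkhorovEDist_le_of_forall_le _ _ _ fun ε B hε hεtop hB => ?_) zero_le
    -- With cost below this threshold, Chebyshev's inequality gives mass at most `ε` to pairs at
    -- distance at least `ε`, which is exactly the Lévy–Prokhorov condition.
    have hc : (0 : ℝ≥0∞) < ε * ε ^ (1 / (p : ℝ)) :=
      ENNReal.mul_pos hε.ne' (ENNReal.rpow_pos hε hεtop.ne).ne'
    obtain ⟨Q, hQ, hlt⟩ := exists_coupling_lt (h ▸ hc)
    have hpR : (p : ℝ) ≠ 0 := by exact_mod_cast hp0
    have cheb := mul_meas_ge_le_pow_eLpNorm' Q hp0 ENNReal.coe_ne_top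
      (f := fun z : H × H => z.1 - z.2) (by fun_prop) ε
    rw [ENNReal.coe_toReal] at cheb
    have hsmall : Q {z | ε ≤ ‖z.1 - z.2‖ₑ} ≤ ε := by
      have h1 := cheb.trans (ENNReal.rpow_le_rpow hlt.le p.coe_nonneg)
      rw [ENNReal.mul_rpow_of_nonneg _ _ p.coe_nonneg, ← ENNReal.rpow_mul, one_div,
        inv_mul_cancel₀ hpR, ENNReal.rpow_one] at h1
      exact (ENNReal.mul_le_mul_iff_right (ENNReal.rpow_pos hε hεtop.ne).ne'
        (ENNReal.rpow_ne_top_of_nonneg p.coe_nonneg hεtop.ne)).1 h1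
    rw [← hQ.1, ← hQ.2, Measure.map_apply measurable_fst hB,
      Measure.map_apply measurable_snd Metric.isOpen_thickening.measurableSet]
    refine (measure_mono (fun z hz => ?_)).trans ((measure_union_le _ _).trans (by gcongr))
    by_contra hcon
    simp only [Set.mem_union, Set.mem_preimage, Set.mem_ofPred_eq, not_or, not_le] at hcon
    refine hcon.1 (Metric.mem_thickening_iff_exists_edist_lt _ _ |>.2 ⟨z.1, hz, ?_⟩)
    rw [ENNReal.ofReal_toReal hεtop.ne, edist_comm, edist_eq_enorm_sub]
    exact hcon.2
  apply Subtype.ext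
  refine ext_of_generate_finite _ (borel_eq_generateFrom_isClosed (α := H) ▸ BorelSpace.measurable_eq)
    isPiSystem_isClosed (fun s hs => ?_) (by simp)
  exact measure_eq_measure_of_levyProkhorovEDist_eq_zero_of_isClosed hLP hs
    ⟨1, one_pos, measure_ne_top _ _⟩ ⟨1, one_pos, measure_ne_top _ _⟩

/-- The Wasserstein extended metric. -/
@[reducible]
noncomputable def wassersteinEMetric (hp : 1 ≤ p) : EMetricSpace (PMoment H p) where
  edist := wasserstein
  edist_self := wasserstein_self
  edist_comm := wasserstein_comm
  edist_triangle := wasserstein_triangle hp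
  eq_of_edist_eq_zero := eq_of_wasserstein_eq_zero hp

/-- Gluing couplings of cost below `2^{-n}` puts a fast Cauchy sequence of laws on one probability
space, where the coordinates are Cauchy in `L^p`. The law of their `L^p` limit is the Wasserstein
limit. -/
lemma completeSpace_wasserstein (hp : 1 ≤ p) :
    @CompleteSpace (PMoment H p) (wassersteinEMetric hp).toUniformSpace := by
  have := UniformSpace.secondCountable_of_separable H
  let _ := wassersteinEMetric (H := H) hp
  refine EMetric.complete_of_convergent_controlled_sequences (fun n => (1 / 2 : ℝ≥0∞) ^ n)
    (fun n => ENNReal.pow_pos (by norm_num) n) fun μ hμ => ?_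
  have : Fact (1 ≤ (p : ℝ≥0∞)) := ⟨by exact_mod_cast hp⟩
  have hQ : ∀ n, ∃ Q ∈ couplings (μ n) (μ (n + 1)),
      eLpNorm (fun z : H × H => z.1 - z.2) p Q < (1 / 2) ^ n := fun n =>
    exists_coupling_lt (hμ n n (n + 1) le_rfl n.le_succ)
  choose Q hQ hQlt using hQ
  obtain ⟨R, hR, hmarg, hdist⟩ := exists_sequence_of_couplings μ Q hQ
  have hmem : ∀ n, MemLp (fun x : ℕ → H => x n) p R := fun n =>
    ⟨(measurable_pi_apply n).aestronglyMeasurable, by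
      rw [eLpNorm_eq_moment (measurable_pi_apply n) (hmarg n)]; exact moment_lt_top _⟩
  have hcau : CauchySeq fun n => (hmem n).toLp := by
    refine cauchySeq_of_edist_le_geometric (1 / 2) 1 (by norm_num) (by norm_num) fun n => ?_
    rw [Lp.edist_toLp_toLp, one_mul]
    exact (hdist n).trans_le (hQlt n).le
  obtain ⟨g, hg⟩ := cauchySeq_tendsto_of_complete hcau
  have hgm : Measurable g := (Lp.stronglyMeasurable g).measurable
  have := Measure.isProbabilityMeasure_map (μ := R) hgm.aemeasurable
  let ν : PMoment H p := ⟨R.map g, this, by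
    rw [eLpNorm_map_measure (by fun_prop) hgm.aemeasurable]; exact (Lp.memLp g).2⟩
  refine ⟨ν, ?_⟩
  rw [tendsto_iff_edist_tendsto_0] at hg ⊢
  refine tendsto_of_tendsto_of_tendsto_of_le_of_le tendsto_const_nhds hg (fun _ => zero_le)
    fun n => ?_
  refine (wasserstein_le_of_map (measurable_pi_apply n) hgm (hmarg n) rfl).trans (le_of_eq ?_)
  rw [Lp.edist_def]
  refine eLpNorm_congr_ae ?_
  filter_upwards [(hmem n).coeFn_toLp] with x hx
  simp [hx]

end WassersteinSpace

/-! ### Discrete Gronwall estimates -/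

section Gronwall

/-- The exponential rate in the discrete Gronwall estimates for `p`-th moments. -/
noncomputable def sewingRate (p : ℝ≥0) (c : ℝ≥0) : ℝ :=
  2 * (2 * c + c ^ 2 + 2 * expansionConst p * c ^ 2)

lemma sewingRate_nonneg {p : ℝ≥0} (hp : 2 ≤ p) (c : ℝ≥0) : 0 ≤ sewingRate p c := by
  have := one_le_expansionConst (p := p) (by exact_mod_cast hp)
  unfold sewingRate
  positivity

/-- Squaring turns the martingale size `√h` into `h`, the same order as the drift term. Only half of
`sewingRate` is spent here; the other half absorbs the inequality `(u + v)² ≤ 2(u² + v²)` in the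
Gronwall recursions. -/
lemma sq_increment_le {p c : ℝ≥0} {x y h : ℝ} (hx : 0 ≤ x) (hxy : x ≤ y)
    (h0 : 0 ≤ h) (h1 : h ≤ 1) :
    (x + c * h * y) ^ 2 + 2 * expansionConst p * (c * √h * y) ^ 2
      ≤ x ^ 2 + sewingRate p c / 2 * h * y ^ 2 := by
  have hc : (0 : ℝ) ≤ c := c.coe_nonneg
  have e : (c * √h * y) ^ 2 = c ^ 2 * h * y ^ 2 := by
    rw [mul_pow, mul_pow, Real.sq_sqrt h0]
  have hy : 0 ≤ y := hx.trans hxy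
  have i1 : 2 * c * h * (x * y) ≤ 2 * c * h * (y * y) := by gcongr
  have i2 : (c : ℝ) ^ 2 * y ^ 2 * (h * h) ≤ c ^ 2 * y ^ 2 * (h * 1) := by gcongr
  rw [e, sewingRate]
  nlinarith

lemma discrete_gronwall {r : ℝ} {e τ : ℕ → ℝ} {N : ℕ} (he : ∀ i, 0 ≤ e i)
    (hstep : ∀ i < N, e (i + 1) ≤ e i + r * (τ (i + 1) - τ i) * e i) :
    e N ≤ Real.exp (r * (τ N - τ 0)) * e 0 := by
  induction N with
  | zero => simp
  | succ N ih =>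
    have h1 := ih fun i hi => hstep i (hi.trans N.lt_succ_self)
    have h2 := hstep N N.lt_succ_self
    calc e (N + 1) ≤ (r * (τ (N + 1) - τ N) + 1) * e N := by linarith
      _ ≤ Real.exp (r * (τ (N + 1) - τ N)) * e N :=
          mul_le_mul_of_nonneg_right (Real.add_one_le_exp _) (he N)
      _ ≤ Real.exp (r * (τ (N + 1) - τ N)) * (Real.exp (r * (τ N - τ 0)) * e 0) := by gcongr
      _ = Real.exp (r * (τ (N + 1) - τ 0)) * e 0 := by
          rw [← mul_assoc, ← Real.exp_add]; ring_nf

end Gronwall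

/-! ### One step of the coupled chain -/

section Chain

variable {H : Type u} [NormedAddCommGroup H] [InnerProductSpace ℝ H] [CompleteSpace H]
  [TopologicalSpace.SeparableSpace H] [MeasurableSpace H] [BorelSpace H] {p : ℝ≥0}
  {Ω : Type v} {mΩ : MeasurableSpace Ω} {ℱ : Filtration ℝ≥0 mΩ} {P : Measure Ω}

lemma LpAt.stronglyMeasurable {s : ℝ≥0} (X : LpAt H ℱ P p s) : StronglyMeasurable[ℱ s] X.1 := by
  have := UniformSpace.secondCountable_of_separable H
  exact X.2.1.stronglyMeasurable

lemma LpAt.memLp {s : ℝ≥0} (X : LpAt H ℱ P p s) : MemLp X.1 p P :=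
  ⟨(X.stronglyMeasurable.mono (ℱ.le s)).aestronglyMeasurable, X.2.2⟩

lemma LpAt.measurable {s : ℝ≥0} (X : LpAt H ℱ P p s) : Measurable X.1 :=
  X.2.1.mono (ℱ.le s) le_rfl

/-- The coupled processes obtained by applying the operators `𝒳` along the grid `b`: the even points
are the end points of the steps, the odd points are the intermediate times. -/
def coupledChain (𝒳 : OperatorFamily H ℱ P p) (b : ℕ → ℝ≥0)
    (X : LpAt H ℱ P p (b 0) × LpAt H ℱ P p (b 0)) :
    ∀ i : ℕ, LpAt H ℱ P p (b (2 * i)) × LpAt H ℱ P p (b (2 * i))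
  | 0 => X
  | i + 1 => 𝒳 (b (2 * i)) (b (2 * i + 1)) (b (2 * (i + 1))) (coupledChain 𝒳 b X i)

variable {Θ : ℝ≥0 → ℝ≥0 → PMoment H p → PMoment H p} {𝒳 : OperatorFamily H ℱ P p} {β : ℝ}
  {L C : ℝ≥0} {b : ℕ → ℝ≥0} {X : LpAt H ℱ P p (b 0) × LpAt H ℱ P p (b 0)}

lemma map_coupledChain_fst (hX : IsCouplingFamily Θ 𝒳 β L C) (hb : Monotone b) {μ : PMoment H p}
    (hμ : P.map X.1.1 = μ.1) (i : ℕ) :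
    P.map (coupledChain 𝒳 b X i).1.1 = (gridScheme Θ (fun i => b (2 * i)) i μ).1 := by
  induction i with
  | zero => exact hμ
  | succ i ih => exact hX.repr_fst _ _ _ (hb (by omega)) (hb (by omega)) _ _ ih

lemma map_coupledChain_snd (hX : IsCouplingFamily Θ 𝒳 β L C) (hb : Monotone b) {ν : PMoment H p}
    (hν : P.map X.2.1 = ν.1) (i : ℕ) :
    P.map (coupledChain 𝒳 b X i).2.1 = (gridScheme Θ b (2 * i) ν).1 := by
  induction i with
  | zero => exact hν
  | succ i ih => exact hX.repr_snd _ _ _ (hb (by omega)) (hb (by omega)) _ _ ih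

variable [IsProbabilityMeasure P]

/-- The base vector `W` is left free: `W = X.1` yields the growth of the chain, and `W = X.1` minus
the starting value yields its displacement. -/
lemma growth_step (hX : IsCouplingFamily Θ 𝒳 β L C) (hp : 2 ≤ p) {s r t : ℝ≥0} (hsr : s ≤ r)
    (hrt : r ≤ t) (ht : t - s ≤ 1) (X : LpAt H ℱ P p s × LpAt H ℱ P p s) {W : Ω → H}
    (hWm : StronglyMeasurable[ℱ s] W) (hW : MemLp W p P) {y : ℝ}
    (hy : 1 + (eLpNorm X.1.1 p P).toReal ≤ y) (hWy : (eLpNorm W p P).toReal ≤ y) :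
    (eLpNorm (W + ((𝒳 s r t X).1.1 - X.1.1)) p P).toReal ^ 2
      ≤ (eLpNorm W p P).toReal ^ 2 + sewingRate p L / 2 * ((t : ℝ) - s) * y ^ 2 := by
  have hst : s ≤ t := hsr.trans hrt
  have hst' : 0 ≤ (t : ℝ) - s := sub_nonneg.2 (by exact_mod_cast hst)
  have hfin : 1 + eLpNorm X.1.1 p P ≠ ∞ := ENNReal.add_ne_top.2 ⟨by simp, X.1.2.2.ne⟩
  have hy' : (1 + eLpNorm X.1.1 p P).toReal ≤ y := by
    rwa [ENNReal.toReal_add (by simp) X.1.2.2.ne, ENNReal.toReal_one]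
  have mean := hX.growth_mean s r t hsr hrt X
  have mart := hX.growth_mart s r t hsr hrt X
  have mean' := ENNReal.toReal_mono (ENNReal.mul_ne_top ENNReal.coe_ne_top hfin) mean
  have mart' := ENNReal.toReal_mono (ENNReal.mul_ne_top ENNReal.coe_ne_top hfin) mart
  rw [ENNReal.toReal_mul, ENNReal.coe_toReal] at mean' mart'
  have key := eLpNorm_add_increment_sq_le (ℱ.le s) hp hWm hW
    ((𝒳 s r t X).1.memLp.sub X.1.memLp)
    (ne_top_of_le_ne_top (ENNReal.mul_ne_top ENNReal.coe_ne_top hfin) mean)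
    (M := L * ((t : ℝ) - s) * y) (V := L * √((t : ℝ) - s) * y)
    (mean'.trans (by push_cast [NNReal.coe_sub hst]; gcongr))
    (mart'.trans (by
      push_cast [NNReal.coe_sub hst]
      rw [Real.sqrt_eq_rpow]
      gcongr))
  refine key.trans (sq_increment_le ENNReal.toReal_nonneg hWy hst' ?_)
  rw [← NNReal.coe_sub hst]; exact_mod_cast ht

/-- The difference of the two increments is itself an increment over `ℱ s`, whose mean and
martingale parts are those bounded by the sewing property; `η` majorizes the local error. -/
lemma sewing_step (hX : IsCouplingFamily Θ 𝒳 β L C) (hp : 2 ≤ p) {s r t : ℝ≥0} (hsr : s ≤ r)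
    (hrt : r ≤ t) (ht : t - s ≤ 1) (X : LpAt H ℱ P p s × LpAt H ℱ P p s) {η : ℝ}
    (hη : (1 + ((eLpNorm X.1.1 p P).toReal + (eLpNorm X.2.1 p P).toReal))
      * ((t : ℝ) - s) ^ β ≤ η) :
    (eLpNorm ((𝒳 s r t X).1.1 - (𝒳 s r t X).2.1) p P).toReal ^ 2
      ≤ (eLpNorm (X.1.1 - X.2.1) p P).toReal ^ 2
        + sewingRate p C / 2 * ((t : ℝ) - s) * ((eLpNorm (X.1.1 - X.2.1) p P).toReal + η) ^ 2 := by
  have hst : s ≤ t := hsr.trans hrt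
  have hst' : 0 ≤ (t : ℝ) - s := sub_nonneg.2 (by exact_mod_cast hst)
  have hd := X.1.memLp.sub X.2.memLp
  have hη0 : 0 ≤ η := le_trans (by positivity) hη
  set R : ℝ≥0∞ := eLpNorm (X.1.1 - X.2.1) p P
    + (1 + (eLpNorm X.1.1 p P + eLpNorm X.2.1 p P)) * ((t - s) ^ β : ℝ≥0) with hR
  have hfin2 : (1 + (eLpNorm X.1.1 p P + eLpNorm X.2.1 p P)) ≠ ∞ :=
    ENNReal.add_ne_top.2 ⟨by simp, ENNReal.add_ne_top.2 ⟨X.1.2.2.ne, X.2.2.2.ne⟩⟩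
  have hfin : R ≠ ∞ := ENNReal.add_ne_top.2 ⟨hd.2.ne, ENNReal.mul_ne_top hfin2 (by simp)⟩
  have hRle : R.toReal ≤ (eLpNorm (X.1.1 - X.2.1) p P).toReal + η := by
    rw [hR, ENNReal.toReal_add hd.2.ne (ENNReal.mul_ne_top hfin2 (by simp)), ENNReal.toReal_mul,
      ENNReal.toReal_add (by simp) (ENNReal.add_ne_top.2 ⟨X.1.2.2.ne, X.2.2.2.ne⟩),
      ENNReal.toReal_add X.1.2.2.ne X.2.2.2.ne, ENNReal.coe_toReal, ENNReal.toReal_one,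
      NNReal.coe_rpow, NNReal.coe_sub hst]
    gcongr
  have mean := hX.sewing_mean s r t hsr hrt X
  have mart := hX.sewing_mart s r t hsr hrt X
  rw [← hR] at mean mart
  set Y := 𝒳 s r t X
  have hp1 : (1 : ℝ≥0∞) ≤ p := by exact_mod_cast (one_le_two.trans hp)
  have hΔ₁ := Y.1.memLp.sub X.1.memLp
  have hΔ₂ := Y.2.memLp.sub X.2.memLp
  set Δ : Ω → H := (Y.2.1 - X.2.1) - (Y.1.1 - X.1.1) with hΔ
  have hcond : P[Δ | ℱ s]
      =ᵐ[P] meanPart ℱ P s X.2.1 Y.2.1 - meanPart ℱ P s X.1.1 Y.1.1 :=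
    condExp_sub (hΔ₂.integrable hp1) (hΔ₁.integrable hp1) _
  have hmart : Δ - P[Δ | ℱ s]
      =ᵐ[P] martPart ℱ P s X.2.1 Y.2.1 - martPart ℱ P s X.1.1 Y.1.1 := by
    filter_upwards [hcond] with ω hω
    simp only [Pi.sub_apply, martPart, meanPart, hΔ] at hω ⊢
    rw [hω]
    abel
  rw [← eLpNorm_congr_ae hcond] at mean
  rw [← eLpNorm_congr_ae hmart] at mart
  have mean' := ENNReal.toReal_mono (ENNReal.mul_ne_top ENNReal.coe_ne_top hfin) mean
  have mart' := ENNReal.toReal_mono (ENNReal.mul_ne_top ENNReal.coe_ne_top hfin) mart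
  rw [ENNReal.toReal_mul, ENNReal.coe_toReal] at mean' mart'
  set y := (eLpNorm (X.1.1 - X.2.1) p P).toReal + η
  have key := eLpNorm_add_increment_sq_le (ℱ.le s) hp
    (X.2.stronglyMeasurable.sub X.1.stronglyMeasurable) (X.2.memLp.sub X.1.memLp) (hΔ₂.sub hΔ₁)
    (ne_top_of_le_ne_top (ENNReal.mul_ne_top ENNReal.coe_ne_top hfin) mean)
    (M := C * ((t : ℝ) - s) * y) (V := C * √((t : ℝ) - s) * y)
    (mean'.trans (by push_cast [NNReal.coe_sub hst]; gcongr))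
    (mart'.trans (by
      push_cast [NNReal.coe_sub hst]
      rw [Real.sqrt_eq_rpow]
      gcongr))
  have e : X.2.1 - X.1.1 + Δ = Y.2.1 - Y.1.1 := by rw [hΔ]; abel
  rw [← hΔ, e, eLpNorm_sub_comm X.2.1, eLpNorm_sub_comm Y.2.1] at key
  refine key.trans (sq_increment_le ENNReal.toReal_nonneg ?_ hst' ?_)
  · exact le_add_of_nonneg_right hη0
  · rw [← NNReal.coe_sub hst]; exact_mod_cast ht

end Chain

/-! ### Realizing prescribed laws from a uniform variable -/

section Realization

/-- A uniform random variable can be transformed into one with any given law on a standard Borel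
space. -/
lemma exists_measurable_map_eq_of_uniform {Ω : Type*} {m mΩ : MeasurableSpace Ω} (hm : m ≤ mΩ)
    {P : Measure Ω} {U : Ω → ℝ} (hU : Measurable[m] U)
    (hlaw : P.map U = volume.restrict (Set.Icc 0 1)) {E : Type*} [MeasurableSpace E]
    [StandardBorelSpace E] [Nonempty E] (Q : Measure E) [IsProbabilityMeasure Q] :
    ∃ f : Ω → E, Measurable[m] f ∧ P.map f = Q := by
  obtain ⟨g, hg, hgQ⟩ := Q.exists_measurable_map_eq
  have hproj : Measurable (Set.projIcc (0 : ℝ) 1 zero_le_one) := continuous_projIcc.measurable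
  refine ⟨fun ω => g (Set.projIcc 0 1 zero_le_one (U ω)), (hg.comp hproj).comp hU, ?_⟩
  have e : (volume.restrict (Set.Icc (0 : ℝ) 1)).map (Set.projIcc (0 : ℝ) 1 zero_le_one)
      = volume := by
    rw [← map_comap_subtype_coe measurableSet_Icc, Measure.map_map hproj measurable_subtype_coe]
    have : Set.projIcc (0 : ℝ) 1 zero_le_one ∘ Subtype.val = id := by
      funext x; simp
    rw [this, Measure.map_id]
    rfl
  have := Measure.map_map (μ := P) (hg.comp hproj) (hU.mono hm le_rfl)
  rw [hlaw, ← Measure.map_map hg hproj, e, hgQ] at this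
  exact this.symm

end Realization

/-! ### The coupled chain along a whole grid -/

section ChainEstimates

variable {H : Type u} [NormedAddCommGroup H] [InnerProductSpace ℝ H] [CompleteSpace H]
  [TopologicalSpace.SeparableSpace H] [MeasurableSpace H] [BorelSpace H] {p : ℝ≥0}
  {Ω : Type v} {mΩ : MeasurableSpace Ω} {ℱ : Filtration ℝ≥0 mΩ} {P : Measure Ω}
  [IsProbabilityMeasure P]
  {Θ : ℝ≥0 → ℝ≥0 → PMoment H p → PMoment H p} {𝒳 : OperatorFamily H ℱ P p} {β : ℝ}
  {L C : ℝ≥0} {b : ℕ → ℝ≥0} {X : LpAt H ℱ P p (b 0) × LpAt H ℱ P p (b 0)}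

/-- Carrying the summand `1` in the Gronwall quantity makes the recursion homogeneous. -/
lemma coupledChain_growth (hX : IsCouplingFamily Θ 𝒳 β L C) (hp : 2 ≤ p) (hb : Monotone b)
    (hstep : ∀ i, b (2 * (i + 1)) - b (2 * i) ≤ 1) (N : ℕ) :
    1 + (eLpNorm (coupledChain 𝒳 b X N).1.1 p P).toReal ^ 2
      ≤ Real.exp (sewingRate p L * (b (2 * N) - b 0))
        * (1 + (eLpNorm X.1.1 p P).toReal ^ 2) := by
  refine discrete_gronwall (r := sewingRate p L) (τ := fun i => (b (2 * i) : ℝ))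
    (e := fun i => 1 + (eLpNorm (coupledChain 𝒳 b X i).1.1 p P).toReal ^ 2)
    (fun i => by positivity) fun i _ => ?_
  set Y := coupledChain 𝒳 b X i with hY
  have key := growth_step hX hp (hb (by omega : 2 * i ≤ 2 * i + 1))
    (hb (by omega : 2 * i + 1 ≤ 2 * (i + 1))) (hstep i) Y Y.1.stronglyMeasurable Y.1.memLp le_rfl
    (by linarith)
  rw [add_sub_cancel] at key
  have hr := sewingRate_nonneg hp L
  have hτ : (0 : ℝ) ≤ b (2 * (i + 1)) - b (2 * i) :=
    sub_nonneg.2 (by exact_mod_cast hb (by omega))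
  set x := (eLpNorm Y.1.1 p P).toReal
  have h1 : (1 + x) ^ 2 ≤ 2 * (1 + x ^ 2) := by nlinarith [sq_nonneg (1 - x)]
  have h2 : sewingRate p L / 2 * ((b (2 * (i + 1)) : ℝ) - b (2 * i)) * (1 + x) ^ 2
      ≤ sewingRate p L / 2 * ((b (2 * (i + 1)) : ℝ) - b (2 * i)) * (2 * (1 + x ^ 2)) := by gcongr
  change 1 + (eLpNorm (𝒳 _ _ _ Y).1.1 p P).toReal ^ 2 ≤ _
  linarith

/-- Once the norms are bounded by `y`, the squared displacement grows by `O(h y²)` per step. Summing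
gives a bound linear in elapsed time, hence Hölder continuity of order 1/2. -/
lemma coupledChain_sub_start (hX : IsCouplingFamily Θ 𝒳 β L C) (hp : 2 ≤ p) (hb : Monotone b)
    (hstep : ∀ i, b (2 * (i + 1)) - b (2 * i) ≤ 1) {y : ℝ} {N : ℕ}
    (hy : ∀ i ≤ N, 1 + (eLpNorm (coupledChain 𝒳 b X i).1.1 p P).toReal ≤ y) :
    (eLpNorm ((coupledChain 𝒳 b X N).1.1 - X.1.1) p P).toReal ^ 2
      ≤ 2 * sewingRate p L * (b (2 * N) - b 0) * y ^ 2 := by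
  induction N with
  | zero => simp [coupledChain]
  | succ N ih =>
    have ih := ih fun i hi => hy i (by omega)
    have hyN := hy N (by omega)
    have hy0 : 1 + (eLpNorm X.1.1 p P).toReal ≤ y := hy 0 (by omega)
    set Y := coupledChain 𝒳 b X N
    have hp1 : (1 : ℝ≥0∞) ≤ p := by exact_mod_cast (one_le_two.trans hp)
    have hX0 : StronglyMeasurable[ℱ (b (2 * N))] X.1.1 :=
      X.1.stronglyMeasurable.mono (ℱ.mono (hb (by omega)))
    -- The step estimate is applied with `2 * y`, so the increment constant becomes `sewingRate p L
    -- / 2 * 4`.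
    have hle : (eLpNorm (Y.1.1 - X.1.1) p P).toReal ≤ 2 * y := by
      have := ENNReal.toReal_mono (ENNReal.add_ne_top.2 ⟨Y.1.2.2.ne, X.1.2.2.ne⟩)
        (eLpNorm_sub_le Y.1.memLp.1 X.1.memLp.1 hp1)
      rw [ENNReal.toReal_add Y.1.2.2.ne X.1.2.2.ne] at this
      linarith
    have key := growth_step hX hp (hb (by omega : 2 * N ≤ 2 * N + 1))
      (hb (by omega : 2 * N + 1 ≤ 2 * (N + 1))) (hstep N) Y (Y.1.stronglyMeasurable.sub hX0)
      (Y.1.memLp.sub X.1.memLp) (y := 2 * y)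
      (by have : 0 ≤ (eLpNorm X.1.1 p P).toReal := ENNReal.toReal_nonneg
          linarith) hle
    have e : Y.1.1 - X.1.1 + ((𝒳 (b (2 * N)) (b (2 * N + 1)) (b (2 * (N + 1))) Y).1.1 - Y.1.1)
      = (𝒳 (b (2 * N)) (b (2 * N + 1)) (b (2 * (N + 1))) Y).1.1 - X.1.1 := by abel
    rw [e] at key
    change (eLpNorm ((𝒳 _ _ _ Y).1.1 - X.1.1) p P).toReal ^ 2 ≤ _
    nlinarith

/-- Adding `η ^ 2` to the squared distance absorbs the local error and leaves a homogeneous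
recursion. -/
lemma coupledChain_fst_sub_snd (hX : IsCouplingFamily Θ 𝒳 β L C) (hp : 2 ≤ p) (hb : Monotone b)
    (hstep : ∀ i, b (2 * (i + 1)) - b (2 * i) ≤ 1) {η : ℝ} {N : ℕ}
    (hη : ∀ i < N, (1 + ((eLpNorm (coupledChain 𝒳 b X i).1.1 p P).toReal
      + (eLpNorm (coupledChain 𝒳 b X i).2.1 p P).toReal))
        * ((b (2 * (i + 1)) : ℝ) - b (2 * i)) ^ β ≤ η) :
    (eLpNorm ((coupledChain 𝒳 b X N).1.1 - (coupledChain 𝒳 b X N).2.1) p P).toReal ^ 2 + η ^ 2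
      ≤ Real.exp (sewingRate p C * (b (2 * N) - b 0))
        * ((eLpNorm (X.1.1 - X.2.1) p P).toReal ^ 2 + η ^ 2) := by
  refine discrete_gronwall (r := sewingRate p C) (τ := fun i => (b (2 * i) : ℝ))
    (e := fun i => (eLpNorm ((coupledChain 𝒳 b X i).1.1 - (coupledChain 𝒳 b X i).2.1) p P).toReal
      ^ 2 + η ^ 2) (fun i => by positivity) fun i hi => ?_
  have hηi := hη i hi
  set Y := coupledChain 𝒳 b X i with hY
  have key := sewing_step hX hp (hb (by omega : 2 * i ≤ 2 * i + 1))
    (hb (by omega : 2 * i + 1 ≤ 2 * (i + 1))) (hstep i) Y hηi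
  have hr := sewingRate_nonneg hp C
  have hτ : (0 : ℝ) ≤ b (2 * (i + 1)) - b (2 * i) :=
    sub_nonneg.2 (by exact_mod_cast hb (by omega))
  set x := (eLpNorm (Y.1.1 - Y.2.1) p P).toReal
  have h1 : (x + η) ^ 2 ≤ 2 * (x ^ 2 + η ^ 2) := by nlinarith [sq_nonneg (x - η)]
  have h2 : sewingRate p C / 2 * ((b (2 * (i + 1)) : ℝ) - b (2 * i)) * (x + η) ^ 2
      ≤ sewingRate p C / 2 * ((b (2 * (i + 1)) : ℝ) - b (2 * i)) * (2 * (x ^ 2 + η ^ 2)) := by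
    gcongr
  change (eLpNorm ((𝒳 _ _ _ Y).1.1 - (𝒳 _ _ _ Y).2.1) p P).toReal ^ 2 + η ^ 2 ≤ _
  linarith

/-- The pair is built from an `ℱ 0`-measurable variable, so it is admissible at every starting time,
and its `L^p` distance is exactly the cost of `Q`. No optimal coupling is required. -/
lemma exists_realization {U : Ω → ℝ} (hU : Measurable[ℱ 0] U)
    (hlaw : P.map U = volume.restrict (Set.Icc 0 1)) {μ ν : PMoment H p} {Q : Measure (H × H)}
    (hQ : Q ∈ couplings μ ν) (s : ℝ≥0) :
    ∃ X : LpAt H ℱ P p s × LpAt H ℱ P p s, P.map X.1.1 = μ.1 ∧ P.map X.2.1 = ν.1 ∧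
      eLpNorm (X.1.1 - X.2.1) p P = eLpNorm (fun z : H × H => z.1 - z.2) p Q := by
  have := UniformSpace.secondCountable_of_separable H
  have := isProbabilityMeasure_of_mem_couplings hQ
  obtain ⟨f, hf, hfQ⟩ := exists_measurable_map_eq_of_uniform (ℱ.le 0) hU hlaw Q
  have hfs : Measurable[ℱ s] f := hf.mono (ℱ.mono zero_le) le_rfl
  have hfm : Measurable f := hf.mono (ℱ.le 0) le_rfl
  have h₁ : P.map (fun ω => (f ω).1) = μ.1 := by
    rw [← hQ.1, ← hfQ, Measure.map_map measurable_fst hfm]; rfl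
  have h₂ : P.map (fun ω => (f ω).2) = ν.1 := by
    rw [← hQ.2, ← hfQ, Measure.map_map measurable_snd hfm]; rfl
  refine ⟨(⟨fun ω => (f ω).1, measurable_fst.comp hfs, ?_⟩,
    ⟨fun ω => (f ω).2, measurable_snd.comp hfs, ?_⟩), h₁, h₂, ?_⟩
  · rw [eLpNorm_eq_moment hfm.fst h₁]; exact moment_lt_top _
  · rw [eLpNorm_eq_moment hfm.snd h₂]; exact moment_lt_top _
  · rw [← hfQ, eLpNorm_map_measure (by fun_prop) hfm.aemeasurable]; rfl

lemma diagonal_mem_couplings (μ : PMoment H p) : μ.1.map (fun x => (x, x)) ∈ couplings μ μ := by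
  constructor <;> rw [Measure.map_map (by fun_prop) (by fun_prop)] <;> exact Measure.map_id

end ChainEstimates

/-! ### Growth, Hölder and comparison estimates for schemes on general grids -/

section GridEstimates

variable {H : Type u} [NormedAddCommGroup H] [InnerProductSpace ℝ H] [CompleteSpace H]
  [TopologicalSpace.SeparableSpace H] [MeasurableSpace H] [BorelSpace H] {p : ℝ≥0}
  {Θ : ℝ≥0 → ℝ≥0 → PMoment H p → PMoment H p} {β : ℝ} {L C : ℝ≥0}

/-- The constant in the growth estimate of the schemes. -/
noncomputable def growthConst (T p L : ℝ≥0) : ℝ≥0 :=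
  2 * NNReal.mk (Real.exp (sewingRate p L * T)) (Real.exp_pos _).le

/-- The constant in the stability estimate of the schemes. -/
noncomputable def stabilityConst (T p C : ℝ≥0) : ℝ≥0 :=
  NNReal.mk (Real.exp (sewingRate p C * T)) (Real.exp_pos _).le

/-- The constant in the Hölder estimate of the schemes. -/
noncomputable def holderConst (T p L : ℝ≥0) : ℝ≥0 :=
  NNReal.mk √(2 * sewingRate p L) (Real.sqrt_nonneg _) * growthConst T p L

/-- The grid `a 0, a 1, a 1, a 2, a 2, …` has `a` as its even points, and in each pair of intervals
the second is degenerate. It allows the coupled chain to be run along an arbitrary grid. -/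
lemma monotone_half {a : ℕ → ℝ≥0} (ha : Monotone a) : Monotone fun j => a ((j + 1) / 2) :=
  fun i j hij => ha (by omega)

lemma half_two_mul (a : ℕ → ℝ≥0) : (fun i => (fun j => a ((j + 1) / 2)) (2 * i)) = a := by
  funext i
  exact congrArg a (by omega)

lemma moment_gridScheme_toReal_le (hS : SewingProperty.{u, v} Θ β L C) (hp : 2 ≤ p)
    {a : ℕ → ℝ≥0} (ha : Monotone a) (hstep : ∀ i, a (i + 1) - a i ≤ 1) {T : ℝ≥0} {N : ℕ}
    (hT : a N ≤ a 0 + T) (μ : PMoment H p) :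
    1 + (moment (gridScheme Θ a N μ)).toReal
      ≤ growthConst T p L * (1 + (moment μ).toReal) := by
  obtain ⟨Ω, mΩ, P, hP, ℱ, ⟨U, hU, hlaw⟩, 𝒳, hX⟩ := hS
  have hb := monotone_half ha
  have hba := half_two_mul a
  set b : ℕ → ℝ≥0 := fun j => a ((j + 1) / 2) with hbdef
  obtain ⟨X, hX₁, -, -⟩ := exists_realization hU hlaw (diagonal_mem_couplings μ) (b 0)
  have key := coupledChain_growth (X := X) hX hp hb
    (fun i => by rw [congrFun hba i, congrFun hba (i + 1)]; exact hstep i) N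
  have hlawN := map_coupledChain_fst hX hb hX₁ N
  rw [hba] at hlawN
  rw [eLpNorm_eq_moment (LpAt.measurable _) hlawN, eLpNorm_eq_moment (LpAt.measurable _) hX₁,
    congrFun hba N, show b 0 = a 0 from rfl] at key
  have hr := sewingRate_nonneg hp L
  have hT' : (a N : ℝ) - a 0 ≤ T := by
    have : (a N : ℝ) ≤ a 0 + T := by exact_mod_cast hT
    linarith
  have h1 : Real.exp (sewingRate p L * (a N - a 0)) ≤ Real.exp (sewingRate p L * T) := by gcongr
  have h2 : 1 ≤ Real.exp (sewingRate p L * T) := Real.one_le_exp (by positivity)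
  set m := (moment μ).toReal
  set m' := (moment (gridScheme Θ a N μ)).toReal
  have hm : 0 ≤ m := ENNReal.toReal_nonneg
  have hm' : 0 ≤ m' := ENNReal.toReal_nonneg
  rw [growthConst]
  push_cast
  set E := Real.exp (sewingRate p L * T)
  have h3 : 1 + m' ^ 2 ≤ E * (1 + m ^ 2) := key.trans (by gcongr)
  refine abs_le_of_sq_le_sq' ?_ (by positivity) |>.2
  have h4 : E * (1 + m) ^ 2 ≤ E ^ 2 * (1 + m) ^ 2 := by
    gcongr
    nlinarith
  nlinarith [sq_nonneg (1 - m')]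

lemma le_coe_mul_of_toReal_le {x m : ℝ≥0∞} {c : ℝ≥0} (hx : x ≠ ∞) (hm : m ≠ ∞)
    (h : x.toReal ≤ c * (1 + m.toReal)) : x ≤ c * (1 + m) := by
  rw [← ENNReal.toReal_le_toReal hx (ENNReal.mul_ne_top (by simp)
    (ENNReal.add_ne_top.2 ⟨by simp, hm⟩)), ENNReal.toReal_mul, ENNReal.toReal_add (by simp) hm]
  simpa using h

lemma moment_gridScheme_le (hS : SewingProperty.{u, v} Θ β L C) (hp : 2 ≤ p)
    {a : ℕ → ℝ≥0} (ha : Monotone a) (hstep : ∀ i, a (i + 1) - a i ≤ 1) {T : ℝ≥0} {N : ℕ}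
    (hT : a N ≤ a 0 + T) (μ : PMoment H p) :
    1 + moment (gridScheme Θ a N μ) ≤ growthConst T p L * (1 + moment μ) := by
  refine le_coe_mul_of_toReal_le (ENNReal.add_ne_top.2 ⟨by simp, (moment_lt_top _).ne⟩)
    (moment_lt_top _).ne ?_
  rw [ENNReal.toReal_add (by simp) (moment_lt_top _).ne, ENNReal.toReal_one]
  exact moment_gridScheme_toReal_le hS hp ha hstep hT μ

lemma wasserstein_gridScheme_self_le (hS : SewingProperty.{u, v} Θ β L C) (hp : 2 ≤ p)
    {a : ℕ → ℝ≥0} (ha : Monotone a) (hstep : ∀ i, a (i + 1) - a i ≤ 1) {T τ : ℝ≥0} {N : ℕ}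
    (hT : a N ≤ a 0 + T) (hτ : a N ≤ a 0 + τ) (μ : PMoment H p) :
    wasserstein (gridScheme Θ a N μ) μ
      ≤ (holderConst T p L * NNReal.sqrt τ : ℝ≥0) * (1 + moment μ) := by
  have hS' := hS
  obtain ⟨Ω, mΩ, P, hP, ℱ, ⟨U, hU, hlaw⟩, 𝒳, hX⟩ := hS
  have hb := monotone_half ha
  have hba := half_two_mul a
  set b : ℕ → ℝ≥0 := fun j => a ((j + 1) / 2) with hbdef
  obtain ⟨X, hX₁, -, -⟩ := exists_realization hU hlaw (diagonal_mem_couplings μ) (b 0)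
  have hlawN := fun i => map_coupledChain_fst hX hb hX₁ i
  rw [hba] at hlawN
  have key := coupledChain_sub_start (X := X) (N := N) hX hp hb
    (fun i => by rw [congrFun hba i, congrFun hba (i + 1)]; exact hstep i)
    (y := growthConst T p L * (1 + (moment μ).toReal)) (fun i hi => by
      rw [eLpNorm_eq_moment (LpAt.measurable _) (hlawN i)]
      exact moment_gridScheme_toReal_le hS' hp ha hstep ((ha hi).trans hT) μ)
  have hbN : (b (2 * N) : ℝ) = a N := congrArg NNReal.toReal (congrFun hba N)
  rw [hbN, show (b 0 : ℝ) = a 0 from rfl] at key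
  refine (wasserstein_le_of_map (LpAt.measurable _) X.1.measurable (hlawN N) hX₁).trans ?_
  refine le_coe_mul_of_toReal_le ((LpAt.memLp _).sub X.1.memLp).2.ne (moment_lt_top _).ne ?_
  have hr := sewingRate_nonneg hp L
  have hτ' : (a N : ℝ) - a 0 ≤ τ := by
    have : (a N : ℝ) ≤ a 0 + τ := by exact_mod_cast hτ
    linarith
  refine abs_le_of_sq_le_sq' (key.trans ?_) (by positivity) |>.2
  rw [holderConst]
  push_cast
  calc 2 * sewingRate p L * (a N - a 0) * (growthConst T p L * (1 + (moment μ).toReal)) ^ 2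
      ≤ 2 * sewingRate p L * τ * (growthConst T p L * (1 + (moment μ).toReal)) ^ 2 := by gcongr
    _ = √(2 * sewingRate p L) ^ 2 * √τ ^ 2
        * (growthConst T p L * (1 + (moment μ).toReal)) ^ 2 := by
        rw [Real.sq_sqrt (by positivity), Real.sq_sqrt (by positivity)]
    _ = _ := by ring

/-- Comparison of the scheme along the even points of a grid with the scheme along the whole grid. -/
lemma wasserstein_gridScheme_le (hS : SewingProperty.{u, v} Θ β L C) (hp : 2 ≤ p) (hβ : 0 < β)
    {b : ℕ → ℝ≥0} (hb : Monotone b) {δ : ℝ≥0} (hδ : δ ≤ 1)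
    (hstep : ∀ i, b (2 * (i + 1)) - b (2 * i) ≤ δ) {T : ℝ≥0} {N : ℕ}
    (hT : b (2 * N) ≤ b 0 + T) (μ ν : PMoment H p) :
    wasserstein (gridScheme Θ (fun i => b (2 * i)) N μ) (gridScheme Θ b (2 * N) ν)
      ≤ stabilityConst T p C * (wasserstein μ ν
        + (growthConst T p L * δ ^ β : ℝ≥0) * ((1 + moment μ) + (1 + moment ν))) := by
  have hS' := hS
  obtain ⟨Ω, mΩ, P, hP, ℱ, ⟨U, hU, hlaw⟩, 𝒳, hX⟩ := hS
  have ha : Monotone fun i => b (2 * i) := fun i j hij => hb (by omega)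
  have hstep1 : ∀ i, b (2 * (i + 1)) - b (2 * i) ≤ 1 := fun i => (hstep i).trans hδ
  have hstep2 : ∀ i, b (i + 1) - b i ≤ 1 := fun i => by
    refine le_trans ?_ (hstep1 (i / 2))
    exact tsub_le_tsub (hb (by omega)) (hb (by omega))
  -- A bound for the local error that is uniform over the steps: the growth estimate controls both
  -- components at all times.
  set κ : ℝ≥0∞ := (growthConst T p L * δ ^ β : ℝ≥0) * ((1 + moment μ) + (1 + moment ν)) with hκ
  have hκtop : κ ≠ ∞ := ENNReal.mul_ne_top ENNReal.coe_ne_top (by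
    simp [(moment_lt_top μ).ne, (moment_lt_top ν).ne])
  have main : ∀ Q ∈ couplings μ ν,
      wasserstein (gridScheme Θ (fun i => b (2 * i)) N μ) (gridScheme Θ b (2 * N) ν)
        ≤ stabilityConst T p C * (eLpNorm (fun z : H × H => z.1 - z.2) p Q + κ) := by
    intro Q hQ
    obtain ⟨X, hX₁, hX₂, hXQ⟩ := exists_realization hU hlaw hQ (b 0)
    have hlaw₁ := fun i => map_coupledChain_fst hX hb hX₁ i
    have hlaw₂ := fun i => map_coupledChain_snd hX hb hX₂ i
    have key := coupledChain_fst_sub_snd (X := X) (N := N) hX hp hb hstep1 (η := κ.toReal)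
      (fun i hi => by
        rw [eLpNorm_eq_moment (LpAt.measurable _) (hlaw₁ i),
          eLpNorm_eq_moment (LpAt.measurable _) (hlaw₂ i)]
        have h1 := moment_gridScheme_toReal_le hS' hp ha hstep1 (N := i) (T := T)
          ((hb (by omega)).trans hT) μ
        have h2 := moment_gridScheme_toReal_le hS' hp hb hstep2 (N := 2 * i) (T := T)
          ((hb (by omega)).trans hT) ν
        have hle : b (2 * i) ≤ b (2 * (i + 1)) := hb (by omega)
        have h3 : ((b (2 * (i + 1)) : ℝ) - b (2 * i)) ^ β ≤ (δ : ℝ) ^ β := by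
          rw [← NNReal.coe_sub hle]
          exact Real.rpow_le_rpow (by positivity) (by exact_mod_cast hstep i) hβ.le
        have h4 : κ.toReal = (growthConst T p L * (1 + (moment μ).toReal)
            + growthConst T p L * (1 + (moment ν).toReal)) * (δ : ℝ) ^ β := by
          rw [hκ, ENNReal.toReal_mul, ENNReal.toReal_add (by simp [(moment_lt_top μ).ne])
            (by simp [(moment_lt_top ν).ne]), ENNReal.toReal_add (by simp) (moment_lt_top μ).ne,
            ENNReal.toReal_add (by simp) (moment_lt_top ν).ne, ENNReal.coe_toReal]
          push_cast
          rw [ENNReal.toReal_one]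
          ring
        rw [h4]
        refine mul_le_mul (by linarith) h3 ?_ (by positivity)
        exact Real.rpow_nonneg (sub_nonneg.2 (by exact_mod_cast hle)) _)
    have hd := X.1.memLp.sub X.2.memLp
    have hdN := (coupledChain 𝒳 b X N).1.memLp.sub (coupledChain 𝒳 b X N).2.memLp
    refine (wasserstein_le_of_map (LpAt.measurable _) (LpAt.measurable _)
      (hlaw₁ N) (hlaw₂ N)).trans ?_
    rw [← hXQ, ← ENNReal.toReal_le_toReal hdN.2.ne (ENNReal.mul_ne_top (by simp)
      (ENNReal.add_ne_top.2 ⟨hd.2.ne, hκtop⟩)), ENNReal.toReal_mul, ENNReal.toReal_add hd.2.ne hκtop,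
      ENNReal.coe_toReal, stabilityConst, NNReal.coe_mk]
    have hr := sewingRate_nonneg hp C
    have hT' : (b (2 * N) : ℝ) - b 0 ≤ T := by
      have : (b (2 * N) : ℝ) ≤ b 0 + T := by exact_mod_cast hT
      linarith
    have h1 : Real.exp (sewingRate p C * (b (2 * N) - b 0)) ≤ Real.exp (sewingRate p C * T) := by
      gcongr
    have h2 : 1 ≤ Real.exp (sewingRate p C * T) := Real.one_le_exp (by positivity)
    set E := Real.exp (sewingRate p C * T)
    set d := (eLpNorm (X.1.1 - X.2.1) p P).toReal
    have hd0 : 0 ≤ d := ENNReal.toReal_nonneg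
    have hk0 : 0 ≤ κ.toReal := ENNReal.toReal_nonneg
    refine abs_le_of_sq_le_sq' ?_ (by positivity) |>.2
    have h3 := key.trans (mul_le_mul_of_nonneg_right h1 (by positivity))
    have h4 : E * (d ^ 2 + κ.toReal ^ 2) ≤ E ^ 2 * (d + κ.toReal) ^ 2 :=
      mul_le_mul (by nlinarith) (by nlinarith) (by positivity) (by positivity)
    rw [mul_pow]
    nlinarith [sq_nonneg κ.toReal]
  -- The bound holds for each coupling; inverting the constant and subtracting `κ` isolates the
  -- cost, so that the infimum can be taken.
  have hS0 : (stabilityConst T p C : ℝ≥0∞) ≠ 0 :=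
    ENNReal.coe_ne_zero.2 (NNReal.coe_ne_zero.1 (Real.exp_pos _).ne')
  exact (ENNReal.inv_mul_le_iff hS0 ENNReal.coe_ne_top).1 (tsub_le_iff_right.1
    (le_iInf₂ fun Q hQ => tsub_le_iff_right.2
      ((ENNReal.inv_mul_le_iff hS0 ENNReal.coe_ne_top).2 (main Q hQ))))

/-- The degenerate steps are identities, so doubling the grid does not change the scheme. -/
lemma gridScheme_half (hΘ : ∀ t, Θ t t = id) (a : ℕ → ℝ≥0) (N : ℕ) :
    gridScheme Θ (fun j => a ((j + 1) / 2)) (2 * N) = gridScheme Θ a N := by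
  induction N with
  | zero => rfl
  | succ N ih =>
    change Θ _ _ ∘ Θ _ _ ∘ gridScheme Θ (fun j => a ((j + 1) / 2)) (2 * N) = Θ _ _ ∘ _
    have e₁ : (Nat.mul 2 N + 1) / 2 = N := by rw [Nat.mul_eq]; omega
    have e₂ : (Nat.mul 2 N + 1 + 1) / 2 = N + 1 := by rw [Nat.mul_eq]; omega
    have e₃ : (Nat.mul 2 N + 1 + 1 + 1) / 2 = N + 1 := by rw [Nat.mul_eq]; omega
    simp only [ih, e₁, e₂, e₃, hΘ]
    rfl

/-- On the doubled grid both components of the chain follow the scheme along `a`, so the comparison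
estimate becomes a stability estimate in the initial law. -/
lemma wasserstein_gridScheme_stability (hS : SewingProperty.{u, v} Θ β L C) (hp : 2 ≤ p)
    (hβ : 0 < β) (hΘ : ∀ t, Θ t t = id) {a : ℕ → ℝ≥0} (ha : Monotone a) {δ : ℝ≥0} (hδ : δ ≤ 1)
    (hstep : ∀ i, a (i + 1) - a i ≤ δ) {T : ℝ≥0} {N : ℕ} (hT : a N ≤ a 0 + T)
    (μ ν : PMoment H p) :
    wasserstein (gridScheme Θ a N μ) (gridScheme Θ a N ν)
      ≤ stabilityConst T p C * (wasserstein μ ν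
        + (growthConst T p L * δ ^ β : ℝ≥0) * ((1 + moment μ) + (1 + moment ν))) := by
  have hba := half_two_mul a
  have key := wasserstein_gridScheme_le hS hp hβ (monotone_half ha) hδ (T := T) (N := N)
    (fun i => (congrArg₂ (· - ·) (congrFun hba (i + 1)) (congrFun hba i)).trans_le (hstep i))
    ((congrFun hba N).trans_le hT) μ ν
  rwa [hba, gridScheme_half hΘ] at key

end GridEstimates

/-! ### Dyadic grids indexed by integers -/

section DyadicGrid

variable {H : Type u} [NormedAddCommGroup H] [MeasurableSpace H] {p : ℝ≥0}

/-- The grid of step `2^{-n}` starting from `i 2^{-n}`. -/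
noncomputable def dyadicGrid (n i : ℕ) (k : ℕ) : ℝ≥0 := ((i + k : ℕ) : ℝ≥0) / 2 ^ n

/-- The scheme along the grid of step `2^{-n}` from `i 2^{-n}` to `j 2^{-n}`. -/
noncomputable def gridStepScheme (Θ : ℝ≥0 → ℝ≥0 → PMoment H p → PMoment H p) (n i j : ℕ) :
    PMoment H p → PMoment H p :=
  gridScheme Θ (dyadicGrid n i) (j - i)

lemma dyadicScheme_eq (Θ : ℝ≥0 → ℝ≥0 → PMoment H p → PMoment H p) (n : ℕ) (s t : ℝ≥0) :
    dyadicScheme Θ n s t = gridStepScheme Θ n ⌊2 ^ n * s⌋₊ ⌊2 ^ n * t⌋₊ := rfl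

lemma gridScheme_add (Θ : ℝ≥0 → ℝ≥0 → PMoment H p → PMoment H p) (a : ℕ → ℝ≥0) (M N : ℕ) :
    gridScheme Θ a (M + N) = gridScheme Θ (fun k => a (M + k)) N ∘ gridScheme Θ a M := by
  induction N with
  | zero => rfl
  | succ N ih =>
    change Θ _ _ ∘ gridScheme Θ a (M + N) = _
    rw [ih]
    rfl

/-- The flow property is exact when the intermediate time is a grid point; the flow of the limit is
inherited from it. -/
lemma gridStepScheme_comp (Θ : ℝ≥0 → ℝ≥0 → PMoment H p → PMoment H p) (n : ℕ) {i j k : ℕ}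
    (hij : i ≤ j) (hjk : j ≤ k) (μ : PMoment H p) :
    gridStepScheme Θ n i k μ = gridStepScheme Θ n j k (gridStepScheme Θ n i j μ) := by
  have e : (fun l => dyadicGrid n i (j - i + l)) = dyadicGrid n j := by
    funext l
    rw [dyadicGrid, dyadicGrid, show i + (j - i + l) = j + l by omega]
  rw [gridStepScheme, show k - i = (j - i) + (k - j) by omega, gridScheme_add, e]
  rfl

lemma dyadicGrid_mono (n i : ℕ) : Monotone (dyadicGrid n i) := fun k l hkl => by
  unfold dyadicGrid
  gcongr

lemma dyadicGrid_step (n i k : ℕ) : dyadicGrid n i (k + 1) - dyadicGrid n i k ≤ 1 / 2 ^ n := by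
  rw [tsub_le_iff_right, dyadicGrid, dyadicGrid, ← add_div]
  gcongr
  push_cast
  rw [← add_assoc, add_comm]

lemma dyadicGrid_last {n i j : ℕ} (hij : i ≤ j) : dyadicGrid n i (j - i) = j / 2 ^ n := by
  rw [dyadicGrid, Nat.add_sub_cancel' hij]

lemma dyadicGrid_two_mul (n i : ℕ) :
    (fun k => dyadicGrid (n + 1) (2 * i) (2 * k)) = dyadicGrid n i := by
  funext k
  rw [dyadicGrid, dyadicGrid, ← mul_add, pow_succ]
  push_cast
  field_simp

end DyadicGrid

/-! ### Dyadic schemes: refinement, dependence on times, convergence -/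

section DyadicEstimates

variable {H : Type u} [NormedAddCommGroup H] [InnerProductSpace ℝ H] [CompleteSpace H]
  [TopologicalSpace.SeparableSpace H] [MeasurableSpace H] [BorelSpace H] {p : ℝ≥0}
  {Θ : ℝ≥0 → ℝ≥0 → PMoment H p → PMoment H p} {β : ℝ} {L C : ℝ≥0}

lemma dyadicStep_le_one (n : ℕ) : (1 : ℝ≥0) / 2 ^ n ≤ 1 :=
  div_le_one_of_le₀ (one_le_pow₀ one_le_two) zero_le

lemma moment_gridStepScheme_le (hS : SewingProperty.{u, v} Θ β L C) (hp : 2 ≤ p) {T : ℝ≥0}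
    {n i j : ℕ} (hij : i ≤ j) (hj : (j : ℝ≥0) / 2 ^ n ≤ T) (μ : PMoment H p) :
    1 + moment (gridStepScheme Θ n i j μ) ≤ growthConst T p L * (1 + moment μ) := by
  refine moment_gridScheme_le hS hp (dyadicGrid_mono n i)
    (fun k => (dyadicGrid_step n i k).trans (dyadicStep_le_one n)) ?_ μ
  rw [dyadicGrid_last hij]
  exact hj.trans le_add_self

lemma wasserstein_gridStepScheme_self_le (hS : SewingProperty.{u, v} Θ β L C) (hp : 2 ≤ p)
    {T τ : ℝ≥0} {n i j : ℕ} (hij : i ≤ j) (hj : (j : ℝ≥0) / 2 ^ n ≤ T)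
    (hτ : (j : ℝ≥0) / 2 ^ n ≤ i / 2 ^ n + τ) (μ : PMoment H p) :
    wasserstein (gridStepScheme Θ n i j μ) μ
      ≤ (holderConst T p L * NNReal.sqrt τ : ℝ≥0) * (1 + moment μ) := by
  refine wasserstein_gridScheme_self_le hS hp (dyadicGrid_mono n i)
    (fun k => (dyadicGrid_step n i k).trans (dyadicStep_le_one n)) ?_ ?_ μ
  · rw [dyadicGrid_last hij]
    exact hj.trans le_add_self
  · rw [dyadicGrid_last hij]
    exact hτ

lemma gridStepScheme_stability (hS : SewingProperty.{u, v} Θ β L C) (hp : 2 ≤ p)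
    (hβ : 0 < β) (hΘ : ∀ t, Θ t t = id) {T : ℝ≥0} {n i j : ℕ} (hij : i ≤ j)
    (hj : (j : ℝ≥0) / 2 ^ n ≤ T) (μ ν : PMoment H p) :
    wasserstein (gridStepScheme Θ n i j μ) (gridStepScheme Θ n i j ν)
      ≤ stabilityConst T p C * (wasserstein μ ν
        + (growthConst T p L * (1 / 2 ^ n) ^ β : ℝ≥0) * ((1 + moment μ) + (1 + moment ν))) := by
  refine wasserstein_gridScheme_stability hS hp hβ hΘ (dyadicGrid_mono n i) (dyadicStep_le_one n)
    (dyadicGrid_step n i) ?_ μ ν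
  rw [dyadicGrid_last hij]
  exact hj.trans le_add_self

/-- The even points of the level `n + 1` grid form the level `n` grid, so the comparison applies
with equal initial laws and leaves only the local error. -/
lemma wasserstein_refine_le (hS : SewingProperty.{u, v} Θ β L C) (hp : 2 ≤ p)
    (hβ : 0 < β) {T : ℝ≥0} {n i j : ℕ} (hij : i ≤ j)
    (hj : (j : ℝ≥0) / 2 ^ n ≤ T) (μ : PMoment H p) :
    wasserstein (gridStepScheme Θ n i j μ) (gridStepScheme Θ (n + 1) (2 * i) (2 * j) μ)
      ≤ (2 * stabilityConst T p C * growthConst T p L * (1 / 2 ^ n) ^ β : ℝ≥0)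
        * (1 + moment μ) := by
  have e := dyadicGrid_two_mul n i
  have key := wasserstein_gridScheme_le hS hp hβ (dyadicGrid_mono (n + 1) (2 * i))
    (dyadicStep_le_one n) (T := T) (N := j - i)
    (fun k => (congrArg₂ (· - ·) (congrFun e (k + 1)) (congrFun e k)).trans_le
      (dyadicGrid_step n i k))
    ((congrFun e (j - i)).trans_le (by
      rw [dyadicGrid_last hij]
      exact hj.trans le_add_self)) μ μ
  rw [e, wasserstein_self, zero_add, ← two_mul] at key
  rw [gridStepScheme, gridStepScheme, ← Nat.mul_sub]
  refine key.trans (le_of_eq ?_)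
  push_cast
  ring

lemma dyadicStep_rpow (n : ℕ) (β : ℝ) : ((1 : ℝ≥0) / 2 ^ n) ^ β = ((1 / 2) ^ β) ^ n := by
  rw [← one_div_pow, ← NNReal.rpow_natCast, ← NNReal.rpow_natCast, ← NNReal.rpow_mul,
    ← NNReal.rpow_mul, mul_comm]

lemma half_rpow_lt_one (hβ : 0 < β) : ((1 : ℝ≥0) / 2) ^ β < 1 :=
  NNReal.rpow_lt_one (by rw [← NNReal.coe_lt_coe]; push_cast; norm_num) hβ

/-- The constant in the comparison of dyadic schemes of different levels. -/
noncomputable def refineConst (β : ℝ) (T p L C : ℝ≥0) : ℝ≥0 :=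
  2 * stabilityConst T p C * growthConst T p L * (1 - (1 / 2) ^ β)⁻¹

lemma wasserstein_refine_iterate_le (hS : SewingProperty.{u, v} Θ β L C) (hp : 2 ≤ p)
    (hβ : 0 < β) {T : ℝ≥0} {n i j : ℕ} (hij : i ≤ j)
    (hj : (j : ℝ≥0) / 2 ^ n ≤ T) (k : ℕ) (μ : PMoment H p) :
    wasserstein (gridStepScheme Θ n i j μ) (gridStepScheme Θ (n + k) (2 ^ k * i) (2 ^ k * j) μ)
      ≤ (refineConst β T p L C * ((1 / 2) ^ β) ^ n : ℝ≥0) * (1 + moment μ) := by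
  have hp1 : 1 ≤ p := one_le_two.trans hp
  set ρ : ℝ≥0 := (1 / 2) ^ β with hρ
  have hρ1 : ρ < 1 := half_rpow_lt_one hβ
  -- Telescoping over the levels; the errors form a geometric series of ratio `2^{-β}`.
  have sum_le : wasserstein (gridStepScheme Θ n i j μ)
      (gridStepScheme Θ (n + k) (2 ^ k * i) (2 ^ k * j) μ)
      ≤ (2 * stabilityConst T p C * growthConst T p L
        * (ρ ^ n * ∑ l ∈ Finset.range k, ρ ^ l) : ℝ≥0) * (1 + moment μ) := by
    induction k with
    | zero => simp [wasserstein_self]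
    | succ k ih =>
      refine (wasserstein_triangle hp1 _ _ _).trans ((add_le_add ih
        (wasserstein_refine_le hS hp hβ (T := T) (n := n + k) (i := 2 ^ k * i) (j := 2 ^ k * j)
          (by gcongr) ?_ μ |>.trans' (le_of_eq ?_))).trans (le_of_eq ?_))
      · push_cast
        rw [pow_add, mul_comm (2 ^ n : ℝ≥0), mul_div_mul_left _ _ (by positivity)]
        exact hj
      · rw [← mul_assoc, ← mul_assoc, ← pow_succ', add_assoc]
      · rw [dyadicStep_rpow, ← hρ, Finset.sum_range_succ, ← add_mul, ← ENNReal.coe_add]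
        congr 2
        rw [pow_add]
        ring
  refine sum_le.trans ?_
  have geom : ∑ l ∈ Finset.range k, ρ ^ l ≤ (1 - ρ)⁻¹ := by
    rw [← NNReal.tsum_geometric hρ1]
    exact (NNReal.summable_geometric hρ1).sum_le_tsum _ fun _ _ => zero_le
  gcongr ?_ * _
  rw [ENNReal.coe_le_coe, refineConst, ← hρ]
  calc _ ≤ 2 * stabilityConst T p C * growthConst T p L * (ρ ^ n * (1 - ρ)⁻¹) := by gcongr
    _ = _ := by ring

/-- The longer scheme is the shorter one followed by a short piece, whose displacement is controlled
by the Hölder bound at a law of controlled moment. -/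
lemma gridStepScheme_endpoint (hS : SewingProperty.{u, v} Θ β L C) (hp : 2 ≤ p)
    {T τ : ℝ≥0} {n i j j' : ℕ} (hij : i ≤ j) (hij' : i ≤ j') (hj : (j : ℝ≥0) / 2 ^ n ≤ T)
    (hj' : (j' : ℝ≥0) / 2 ^ n ≤ T) (hτ : (j : ℝ≥0) / 2 ^ n ≤ j' / 2 ^ n + τ)
    (hτ' : (j' : ℝ≥0) / 2 ^ n ≤ j / 2 ^ n + τ) (μ : PMoment H p) :
    wasserstein (gridStepScheme Θ n i j μ) (gridStepScheme Θ n i j' μ)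
      ≤ (holderConst T p L * growthConst T p L * NNReal.sqrt τ : ℝ≥0) * (1 + moment μ) := by
  wlog hjj : j ≤ j' generalizing j j'
  · rw [wasserstein_comm]
    exact this hij' hij hj' hj hτ' hτ (le_of_not_ge hjj)
  rw [gridStepScheme_comp Θ n hij hjj, wasserstein_comm]
  calc _ ≤ ((holderConst T p L * NNReal.sqrt τ : ℝ≥0) : ℝ≥0∞)
        * (1 + moment (gridStepScheme Θ n i j μ)) :=
        wasserstein_gridStepScheme_self_le hS hp hjj hj' hτ' _
    _ ≤ ((holderConst T p L * NNReal.sqrt τ : ℝ≥0) : ℝ≥0∞)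
        * (growthConst T p L * (1 + moment μ)) := by
        gcongr
        exact moment_gridStepScheme_le hS hp hij hj μ
    _ = _ := by push_cast; ring

/-- The constant in the joint continuity estimate of the schemes. -/
noncomputable def continuityConst (T p L C : ℝ≥0) : ℝ≥0 :=
  holderConst T p L + holderConst T p L * growthConst T p L
    + stabilityConst T p C * holderConst T p L
    + stabilityConst T p C * growthConst T p L * (growthConst T p L + 1)

lemma gridStepScheme_continuity (hS : SewingProperty.{u, v} Θ β L C) (hp : 2 ≤ p)
    (hβ : 0 < β) (hΘ : ∀ t, Θ t t = id) {T σ τ : ℝ≥0} {n i j i' j' : ℕ} (hij : i ≤ j)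
    (hij' : i' ≤ j') (hj : (j : ℝ≥0) / 2 ^ n ≤ T) (hj' : (j' : ℝ≥0) / 2 ^ n ≤ T)
    (hσ : (i : ℝ≥0) / 2 ^ n ≤ i' / 2 ^ n + σ) (hσ' : (i' : ℝ≥0) / 2 ^ n ≤ i / 2 ^ n + σ)
    (hτ : (j : ℝ≥0) / 2 ^ n ≤ j' / 2 ^ n + τ) (hτ' : (j' : ℝ≥0) / 2 ^ n ≤ j / 2 ^ n + τ)
    (μ : PMoment H p) :
    wasserstein (gridStepScheme Θ n i j μ) (gridStepScheme Θ n i' j' μ)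
      ≤ (continuityConst T p L C * (NNReal.sqrt σ + NNReal.sqrt τ + ((1 / 2) ^ β) ^ n) : ℝ≥0)
        * (1 + moment μ) := by
  have hp1 : 1 ≤ p := one_le_two.trans hp
  wlog hii : i ≤ i' generalizing i j i' j'
  · rw [wasserstein_comm]
    exact this hij' hij hj' hj hσ' hσ hτ' hτ (le_of_not_ge hii)
  set G := growthConst T p L with hG
  set S := stabilityConst T p C with hSC
  set h := holderConst T p L with hh
  set ρ : ℝ≥0 := (1 / 2) ^ β with hρ
  have hK : continuityConst T p L C = h + h * G + S * h + S * G * (G + 1) := rfl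
  rw [hK]
  -- If the intervals overlap, the start is moved by stability (the source of the mesh error) and
  -- then the end by the endpoint estimate. If `j < i'`, the lengths of the two intervals are at
  -- most `σ` and `τ`, so both laws are close to `μ` itself.
  rcases le_or_gt i' j with hi'j | hi'j
  · have hi'T : (i' : ℝ≥0) / 2 ^ n ≤ T := le_trans (by gcongr) hj
    have first : wasserstein (gridStepScheme Θ n i j μ) (gridStepScheme Θ n i' j μ)
        ≤ (S * h * NNReal.sqrt σ + S * G * (G + 1) * ρ ^ n : ℝ≥0) * (1 + moment μ) := by
      rw [gridStepScheme_comp Θ n hii hi'j]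
      refine (gridStepScheme_stability hS hp hβ hΘ hi'j hj _ _).trans ?_
      rw [← hG, ← hSC, dyadicStep_rpow, ← hρ]
      calc _ ≤ (S : ℝ≥0∞) * ((h * NNReal.sqrt σ : ℝ≥0) * (1 + moment μ)
            + (G * ρ ^ n : ℝ≥0) * (G * (1 + moment μ) + (1 + moment μ))) := by
            gcongr
            · exact wasserstein_gridStepScheme_self_le hS hp hii hi'T hσ' μ
            · exact moment_gridStepScheme_le hS hp hii hi'T μ
        _ = _ := by push_cast; ring
    have second := gridStepScheme_endpoint hS hp hi'j hij' hj hj' hτ hτ' μ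
    rw [← hG, ← hh] at second
    refine (wasserstein_triangle hp1 _ _ _).trans ((add_le_add first second).trans ?_)
    rw [← add_mul, ← ENNReal.coe_add]
    gcongr
    rw [← NNReal.coe_le_coe]
    push_cast
    have h1 : 0 ≤ (h : ℝ) * √(σ : ℝ) := by positivity
    have h2 : 0 ≤ (h : ℝ) * G * √(σ : ℝ) := by positivity
    have h3 : 0 ≤ (S : ℝ) * G * (G + 1) * √(σ : ℝ) := by positivity
    have h4 : 0 ≤ ((h : ℝ) + S * h + S * G * (G + 1)) * √(τ : ℝ) := by positivity
    have h5 : 0 ≤ ((h : ℝ) + h * G + S * h) * (ρ : ℝ) ^ n := by positivity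
    nlinarith
  · have hi'j' : (i' : ℝ≥0) / 2 ^ n ≤ j' / 2 ^ n := by gcongr
    have hji' : (j : ℝ≥0) / 2 ^ n ≤ i' / 2 ^ n := by gcongr
    have first := wasserstein_gridStepScheme_self_le hS hp hij hj (hji'.trans hσ') μ
    have second := wasserstein_gridStepScheme_self_le hS hp hij' hj'
      (hτ'.trans (add_le_add_left hji' τ)) μ
    rw [wasserstein_comm] at second
    rw [← hh] at first second
    refine (wasserstein_triangle hp1 _ _ _).trans ((add_le_add first second).trans ?_)
    rw [← add_mul, ← ENNReal.coe_add]
    gcongr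
    rw [← NNReal.coe_le_coe]
    push_cast
    have h1 : 0 ≤ ((h : ℝ) * G + S * h + S * G * (G + 1)) * √(σ : ℝ) := by positivity
    have h2 : 0 ≤ ((h : ℝ) * G + S * h + S * G * (G + 1)) * √(τ : ℝ) := by positivity
    have h5 : 0 ≤ ((h : ℝ) + h * G + S * h + S * G * (G + 1)) * (ρ : ℝ) ^ n := by positivity
    nlinarith

lemma floor_div_le (n : ℕ) (s : ℝ≥0) : (⌊2 ^ n * s⌋₊ : ℝ≥0) / 2 ^ n ≤ s := by
  rw [div_le_iff₀ (by positivity), mul_comm]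
  exact Nat.floor_le zero_le

lemma le_floor_div_add (n : ℕ) (s : ℝ≥0) :
    s ≤ (⌊2 ^ n * s⌋₊ : ℝ≥0) / 2 ^ n + 1 / 2 ^ n := by
  rw [← add_div, le_div_iff₀ (by positivity), mul_comm]
  exact (Nat.lt_floor_add_one _).le

lemma floor_two_pow_mono (n : ℕ) {s t : ℝ≥0} (hst : s ≤ t) : ⌊2 ^ n * s⌋₊ ≤ ⌊2 ^ n * t⌋₊ := by
  gcongr

lemma floor_div_le_add_nndist (n : ℕ) (s s' : ℝ≥0) :
    (⌊2 ^ n * s⌋₊ : ℝ≥0) / 2 ^ n ≤ (⌊2 ^ n * s'⌋₊ : ℝ≥0) / 2 ^ n + (nndist s s' + 1 / 2 ^ n) := by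
  have h : s ≤ s' + nndist s s' := by
    rw [← NNReal.coe_le_coe, NNReal.coe_add, coe_nndist, NNReal.dist_eq]
    linarith [le_abs_self ((s : ℝ) - s')]
  calc _ ≤ s := floor_div_le n s
    _ ≤ s' + nndist s s' := h
    _ ≤ ((⌊2 ^ n * s'⌋₊ : ℝ≥0) / 2 ^ n + 1 / 2 ^ n) + nndist s s' := by
        gcongr
        exact le_floor_div_add n s'
    _ = _ := by ring

lemma dyadicScheme_continuity (hS : SewingProperty.{u, v} Θ β L C) (hp : 2 ≤ p)
    (hβ : 0 < β) (hΘ : ∀ t, Θ t t = id) {T s t s' t' : ℝ≥0} (hst : s ≤ t) (ht : t ≤ T)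
    (hst' : s' ≤ t') (ht' : t' ≤ T) (n : ℕ) (μ : PMoment H p) :
    wasserstein (dyadicScheme Θ n s t μ) (dyadicScheme Θ n s' t' μ)
      ≤ (continuityConst T p L C * (NNReal.sqrt (nndist s s' + 1 / 2 ^ n)
        + NNReal.sqrt (nndist t t' + 1 / 2 ^ n) + ((1 / 2) ^ β) ^ n) : ℝ≥0) * (1 + moment μ) := by
  rw [dyadicScheme_eq, dyadicScheme_eq]
  refine gridStepScheme_continuity hS hp hβ hΘ (floor_two_pow_mono n hst)
    (floor_two_pow_mono n hst') ((floor_div_le n t).trans ht) ((floor_div_le n t').trans ht')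
    (floor_div_le_add_nndist n s s') ?_ (floor_div_le_add_nndist n t t') ?_ μ
  · rw [nndist_comm]; exact floor_div_le_add_nndist n s' s
  · rw [nndist_comm]; exact floor_div_le_add_nndist n t' t

/-- The rate of convergence of the dyadic schemes. -/
noncomputable def dyadicError (β : ℝ) (T p L C : ℝ≥0) (n : ℕ) : ℝ≥0 :=
  refineConst β T p L C * ((1 / 2) ^ β) ^ n
    + continuityConst T p L C * (NNReal.sqrt (1 / 2 ^ n) + NNReal.sqrt (1 / 2 ^ n)
      + ((1 / 2) ^ β) ^ n)

/-- Two errors: refining the level-`n` grid with its end points fixed, then moving those end points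
to the level-`n + k` floors, which shifts each by at most `2^{-n}`. -/
lemma dyadicScheme_cauchy (hS : SewingProperty.{u, v} Θ β L C) (hp : 2 ≤ p)
    (hβ : 0 < β) (hΘ : ∀ t, Θ t t = id) {T s t : ℝ≥0} (hst : s ≤ t) (ht : t ≤ T) (n k : ℕ)
    (μ : PMoment H p) :
    wasserstein (dyadicScheme Θ n s t μ) (dyadicScheme Θ (n + k) s t μ)
      ≤ dyadicError β T p L C n * (1 + moment μ) := by
  have hp1 : 1 ≤ p := one_le_two.trans hp
  have hij := floor_two_pow_mono n hst
  have hjT : (⌊2 ^ n * t⌋₊ : ℝ≥0) / 2 ^ n ≤ T := (floor_div_le n t).trans ht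
  have scale : ∀ i : ℕ, ((2 ^ k * i : ℕ) : ℝ≥0) / 2 ^ (n + k) = i / 2 ^ n := fun i => by
    push_cast
    rw [pow_add, mul_comm (2 ^ n : ℝ≥0), mul_div_mul_left _ _ (by positivity)]
  have hstep : (1 : ℝ≥0) / 2 ^ (n + k) ≤ 1 / 2 ^ n := by
    gcongr
    · exact one_le_two
    · omega
  have upper : ∀ x : ℝ≥0, ((2 ^ k * ⌊2 ^ n * x⌋₊ : ℕ) : ℝ≥0) / 2 ^ (n + k)
      ≤ ⌊2 ^ (n + k) * x⌋₊ / 2 ^ (n + k) + 1 / 2 ^ n := fun x => by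
    rw [scale]
    exact (floor_div_le n x).trans ((le_floor_div_add (n + k) x).trans (by gcongr))
  have lower : ∀ x : ℝ≥0, (⌊2 ^ (n + k) * x⌋₊ : ℝ≥0) / 2 ^ (n + k)
      ≤ ((2 ^ k * ⌊2 ^ n * x⌋₊ : ℕ) : ℝ≥0) / 2 ^ (n + k) + 1 / 2 ^ n := fun x => by
    rw [scale]
    exact (floor_div_le (n + k) x).trans (le_floor_div_add n x)
  have first := wasserstein_refine_iterate_le hS hp hβ hij hjT k μ
  have second := gridStepScheme_continuity hS hp hβ hΘ (n := n + k)
    (Nat.mul_le_mul_left (2 ^ k) hij) (floor_two_pow_mono (n + k) hst)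
    ((scale _).trans_le hjT) ((floor_div_le (n + k) t).trans ht)
    (upper s) (lower s) (upper t) (lower t) μ
  rw [dyadicScheme_eq, dyadicScheme_eq]
  refine (wasserstein_triangle hp1 _ _ _).trans ((add_le_add first second).trans ?_)
  rw [← add_mul, ← ENNReal.coe_add, dyadicError]
  have hρ := (half_rpow_lt_one hβ).le
  gcongr ?_ * _
  rw [ENNReal.coe_le_coe]
  gcongr _ + _ * (_ + ?_)
  exact pow_le_pow_of_le_one zero_le hρ (by omega)

lemma tendsto_half_rpow_pow (hβ : 0 < β) :
    Tendsto (fun n : ℕ => (((1 : ℝ≥0) / 2) ^ β) ^ n) atTop (𝓝 0) :=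
  tendsto_pow_atTop_nhds_zero_of_lt_one zero_le (half_rpow_lt_one hβ)

lemma tendsto_dyadicStep : Tendsto (fun n : ℕ => (1 : ℝ≥0) / 2 ^ n) atTop (𝓝 0) := by
  simp_rw [← one_div_pow]
  refine tendsto_pow_atTop_nhds_zero_of_lt_one zero_le ?_
  rw [← NNReal.coe_lt_coe]; push_cast; norm_num

lemma tendsto_sqrt_add_dyadicStep (x : ℝ≥0) :
    Tendsto (fun n : ℕ => NNReal.sqrt (x + 1 / 2 ^ n)) atTop (𝓝 (NNReal.sqrt x)) := by
  have h := tendsto_const_nhds (x := x) |>.add tendsto_dyadicStep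
  rw [add_zero] at h
  exact (NNReal.continuous_sqrt.tendsto x).comp h

lemma tendsto_dyadicError (hβ : 0 < β) (T p L C : ℝ≥0) :
    Tendsto (dyadicError β T p L C) atTop (𝓝 0) := by
  have h1 := tendsto_half_rpow_pow hβ
  have h2 := tendsto_sqrt_add_dyadicStep 0
  simp only [zero_add, NNReal.sqrt_zero] at h2
  have := (h1.const_mul (refineConst β T p L C)).add
    (((h2.add h2).add h1).const_mul (continuityConst T p L C))
  rw [add_zero, add_zero, mul_zero, mul_zero, add_zero] at this
  exact this

lemma exists_dyadicScheme_limit (hS : SewingProperty.{u, v} Θ β L C) (hp : 2 ≤ p)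
    (hβ : 0 < β) (hΘ : ∀ t, Θ t t = id) {s t : ℝ≥0} (hst : s ≤ t) (μ : PMoment H p) :
    ∃ ν : PMoment H p,
      Tendsto (fun n => wasserstein (dyadicScheme Θ n s t μ) ν) atTop (𝓝 0) := by
  have hp1 : 1 ≤ p := one_le_two.trans hp
  let _ := wassersteinEMetric (H := H) hp1
  have := completeSpace_wasserstein (H := H) hp1
  have herr : Tendsto (fun n => (dyadicError β t p L C n : ℝ≥0∞) * (1 + moment μ)) atTop (𝓝 0) := by
    have h := ENNReal.Tendsto.mul_const (b := 1 + moment μ)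
      (ENNReal.tendsto_coe.2 (tendsto_dyadicError hβ t p L C))
      (Or.inr (ENNReal.add_ne_top.2 ⟨by simp, (moment_lt_top μ).ne⟩))
    simpa using h
  have hcau : CauchySeq fun n => dyadicScheme Θ n s t μ := by
    rw [EMetric.cauchySeq_iff']
    intro ε hε
    obtain ⟨N, hN⟩ := (herr.eventually_lt_const hε).exists
    refine ⟨N, fun n hn => ?_⟩
    obtain ⟨k, rfl⟩ := Nat.exists_eq_add_of_le hn
    rw [edist_comm]
    exact (dyadicScheme_cauchy hS hp hβ hΘ hst le_rfl N k μ).trans_lt hN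
  obtain ⟨ν, hν⟩ := cauchySeq_tendsto_of_complete hcau
  exact ⟨ν, tendsto_iff_edist_tendsto_0.1 hν⟩

end DyadicEstimates

/-! ### Passage to the limit -/

section Limit

variable {H : Type u} [NormedAddCommGroup H] [InnerProductSpace ℝ H] [CompleteSpace H]
  [TopologicalSpace.SeparableSpace H] [MeasurableSpace H] [BorelSpace H] {p : ℝ≥0}
  {Θ : ℝ≥0 → ℝ≥0 → PMoment H p → PMoment H p} {β : ℝ} {L C : ℝ≥0}

lemma wasserstein_triangle₄ (hp : 1 ≤ p) (μ₀ μ₁ μ₂ μ₃ : PMoment H p) :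
    wasserstein μ₀ μ₃ ≤ wasserstein μ₁ μ₀ + wasserstein μ₁ μ₂ + wasserstein μ₂ μ₃ := by
  rw [wasserstein_comm μ₁ μ₀]
  exact (wasserstein_triangle hp μ₀ μ₂ μ₃).trans
    (add_le_add (wasserstein_triangle hp μ₀ μ₁ μ₂) le_rfl)

lemma one_add_moment_ne_top (μ : PMoment H p) : 1 + moment μ ≠ ∞ :=
  ENNReal.add_ne_top.2 ⟨by simp, (moment_lt_top μ).ne⟩

/-- The stability estimate passes to the limit as the step goes to zero. -/
lemma tendsto_stability_bound (hβ : 0 < β) (S G : ℝ≥0) {w : ℕ → ℝ≥0∞} {w₀ κ : ℝ≥0∞}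
    (hw : Tendsto w atTop (𝓝 w₀)) (hκ : κ ≠ ∞) :
    Tendsto (fun n : ℕ => (S : ℝ≥0∞) * (w n + (G * (1 / 2 ^ n) ^ β : ℝ≥0) * κ)) atTop
      (𝓝 (S * w₀)) := by
  simp_rw [dyadicStep_rpow]
  have h1 := ENNReal.tendsto_coe.2 ((tendsto_half_rpow_pow hβ).const_mul G)
  have h2 := ENNReal.Tendsto.mul_const (b := κ) h1 (Or.inr hκ)
  have h3 := ENNReal.Tendsto.const_mul (a := (S : ℝ≥0∞)) (hw.add h2) (Or.inr ENNReal.coe_ne_top)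
  simpa using h3

lemma moment_le_of_tendsto (hS : SewingProperty.{u, v} Θ β L C) (hp : 2 ≤ p)
    {s t T : ℝ≥0} (hst : s ≤ t) (ht : t ≤ T) {μ ν : PMoment H p}
    (h : Tendsto (fun n => wasserstein (dyadicScheme Θ n s t μ) ν) atTop (𝓝 0)) :
    moment ν ≤ growthConst T p L * (1 + moment μ) := by
  have hlim := h.const_add (growthConst T p L * (1 + moment μ) : ℝ≥0∞)
  rw [add_zero] at hlim
  refine ge_of_tendsto' hlim fun n => ?_
  refine (moment_le_add_wasserstein (one_le_two.trans hp) _ (dyadicScheme Θ n s t μ)).trans ?_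
  rw [wasserstein_comm]
  gcongr
  exact le_add_self.trans (moment_gridStepScheme_le hS hp (floor_two_pow_mono n hst)
    ((floor_div_le n t).trans ht) μ)

/-- The mesh error in the stability estimate tends to zero, so neither `β` nor the growth constant
survives in the Lipschitz constant. -/
lemma wasserstein_limit_le (hS : SewingProperty.{u, v} Θ β L C) (hp : 2 ≤ p)
    (hβ : 0 < β) (hΘ : ∀ t, Θ t t = id) {s t T : ℝ≥0} (hst : s ≤ t) (ht : t ≤ T)
    {μ μ' ν ν' : PMoment H p}
    (h : Tendsto (fun n => wasserstein (dyadicScheme Θ n s t μ) ν) atTop (𝓝 0))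
    (h' : Tendsto (fun n => wasserstein (dyadicScheme Θ n s t μ') ν') atTop (𝓝 0)) :
    wasserstein ν ν' ≤ stabilityConst T p C * wasserstein μ μ' := by
  have hlim := (h.add (tendsto_stability_bound hβ (stabilityConst T p C) (growthConst T p L)
    (tendsto_const_nhds (x := wasserstein μ μ')) (ENNReal.add_ne_top.2
      ⟨one_add_moment_ne_top μ, one_add_moment_ne_top μ'⟩))).add h'
  rw [zero_add, add_zero] at hlim
  refine ge_of_tendsto' hlim fun n => ?_
  refine (wasserstein_triangle₄ (one_le_two.trans hp) ν (dyadicScheme Θ n s t μ)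
    (dyadicScheme Θ n s t μ') ν').trans ?_
  gcongr
  exact gridStepScheme_stability hS hp hβ hΘ (floor_two_pow_mono n hst)
    ((floor_div_le n t).trans ht) μ μ'

lemma wasserstein_limit_times_le (hS : SewingProperty.{u, v} Θ β L C) (hp : 2 ≤ p)
    (hβ : 0 < β) (hΘ : ∀ t, Θ t t = id) {s t s' t' T : ℝ≥0} (hst : s ≤ t) (ht : t ≤ T)
    (hst' : s' ≤ t') (ht' : t' ≤ T) {μ ν ν' : PMoment H p}
    (h : Tendsto (fun n => wasserstein (dyadicScheme Θ n s t μ) ν) atTop (𝓝 0))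
    (h' : Tendsto (fun n => wasserstein (dyadicScheme Θ n s' t' μ) ν') atTop (𝓝 0)) :
    wasserstein ν ν' ≤ (continuityConst T p L C
      * (NNReal.sqrt (nndist s s') + NNReal.sqrt (nndist t t')) : ℝ≥0) * (1 + moment μ) := by
  have h1 := (((tendsto_sqrt_add_dyadicStep (nndist s s')).add
    (tendsto_sqrt_add_dyadicStep (nndist t t'))).add (tendsto_half_rpow_pow hβ)).const_mul
      (continuityConst T p L C)
  have h2 := ENNReal.Tendsto.mul_const (b := 1 + moment μ) (ENNReal.tendsto_coe.2 h1)
    (Or.inr (one_add_moment_ne_top μ))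
  have hlim := (h.add h2).add h'
  rw [zero_add, add_zero, add_zero] at hlim
  refine ge_of_tendsto' hlim fun n => ?_
  refine (wasserstein_triangle₄ (one_le_two.trans hp) ν (dyadicScheme Θ n s t μ)
    (dyadicScheme Θ n s' t' μ) ν').trans ?_
  gcongr
  exact dyadicScheme_continuity hS hp hβ hΘ hst ht hst' ht' n μ

/-- The scheme from `s` to `t` is the scheme from `r` to `t` applied to the level-`n` approximation
of `ν'`. Stability, with the moments of these approximations bounded in `n`, allows replacing them
by `ν'` in the limit. -/
lemma limit_flow (hS : SewingProperty.{u, v} Θ β L C) (hp : 2 ≤ p)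
    (hβ : 0 < β) (hΘ : ∀ t, Θ t t = id) {s r t : ℝ≥0} (hsr : s ≤ r) (hrt : r ≤ t)
    {μ ν ν' ν'' : PMoment H p}
    (h : Tendsto (fun n => wasserstein (dyadicScheme Θ n s t μ) ν) atTop (𝓝 0))
    (h' : Tendsto (fun n => wasserstein (dyadicScheme Θ n s r μ) ν') atTop (𝓝 0))
    (h'' : Tendsto (fun n => wasserstein (dyadicScheme Θ n r t ν') ν'') atTop (𝓝 0)) :
    ν = ν'' := by
  have hp1 : 1 ≤ p := one_le_two.trans hp
  refine eq_of_wasserstein_eq_zero hp1 (le_antisymm ?_ zero_le)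
  have hlim := (h.add (tendsto_stability_bound hβ (stabilityConst t p C) (growthConst t p L)
    h' (κ := growthConst t p L * (1 + moment μ) + (1 + moment ν')) (ENNReal.add_ne_top.2
      ⟨ENNReal.mul_ne_top ENNReal.coe_ne_top (one_add_moment_ne_top μ),
        one_add_moment_ne_top ν'⟩))).add h''
  rw [zero_add, add_zero, mul_zero] at hlim
  refine ge_of_tendsto' hlim fun n => ?_
  refine (wasserstein_triangle₄ hp1 ν (dyadicScheme Θ n s t μ)
    (dyadicScheme Θ n r t ν') ν'').trans ?_
  refine add_le_add (add_le_add le_rfl ?_) le_rfl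
  rw [dyadicScheme_eq, dyadicScheme_eq, dyadicScheme_eq,
    gridStepScheme_comp Θ n (floor_two_pow_mono n hsr) (floor_two_pow_mono n hrt)]
  refine (gridStepScheme_stability hS hp hβ hΘ (floor_two_pow_mono n hrt)
    (floor_div_le n t) _ _).trans ?_
  gcongr
  exact moment_gridStepScheme_le hS hp (floor_two_pow_mono n hsr)
    ((floor_div_le n r).trans hrt) μ

end Limit

end WassersteinSewing

/-! ### Main theorem -/

theorem theorem2p6 :
    -- the constants `A` (of `T, p, L`) and `K` (of `T, p, L, C`)
    ∃ (A : ℝ≥0 → ℝ≥0 → ℝ≥0 → ℝ≥0) (K : ℝ≥0 → ℝ≥0 → ℝ≥0 → ℝ≥0 → ℝ≥0),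
    ∀ (H : Type u) [NormedAddCommGroup H] [InnerProductSpace ℝ H] [CompleteSpace H]
      [TopologicalSpace.SeparableSpace H] [MeasurableSpace H] [BorelSpace H]
      (p : ℝ≥0) (_ : 2 ≤ p) (β : ℝ) (_ : 0 < β) (L C : ℝ≥0) (_ : 0 < L) (_ : 0 < C)
      (Θ : ℝ≥0 → ℝ≥0 → WassersteinSewing.PMoment H p → WassersteinSewing.PMoment H p)
      (_ : ∀ t, Θ t t = id)
      (_ : WassersteinSewing.SewingProperty.{u, v} Θ β L C)
      (_ : WassersteinSewing.ContinuityProperty Θ),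
    ∃ θ : ℝ≥0 → ℝ≥0 → WassersteinSewing.PMoment H p → WassersteinSewing.PMoment H p,
      -- flow property
      (∀ s r t : ℝ≥0, s ≤ r → r ≤ t → θ s t = θ r t ∘ θ s r) ∧
      -- convergence of the dyadic schemes
      (∀ s t : ℝ≥0, s < t → ∀ μ : WassersteinSewing.PMoment H p,
        Tendsto (fun n : ℕ => WassersteinSewing.wasserstein
          (WassersteinSewing.dyadicScheme Θ n s t μ) (θ s t μ)) atTop (𝓝 0)) ∧
      ∀ T : ℝ≥0, 0 < T →
        -- linear growth
        (∀ s t : ℝ≥0, s < t → t ≤ T → ∀ μ : WassersteinSewing.PMoment H p,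
          WassersteinSewing.moment (θ s t μ) ≤
            (A T p L : ℝ≥0∞) * (1 + WassersteinSewing.moment μ)) ∧
        -- Lipschitz property
        (∀ s t : ℝ≥0, s < t → t ≤ T → ∀ μ ν : WassersteinSewing.PMoment H p,
          WassersteinSewing.wasserstein (θ s t μ) (θ s t ν) ≤
            (K T p L C : ℝ≥0∞) * WassersteinSewing.wasserstein μ ν) ∧
        -- continuity in `(s, t)`, uniform in `μ` with weight `1 + ‖μ‖_p`
        (∀ ε : ℝ≥0, 0 < ε → ∃ δ : ℝ, 0 < δ ∧ ∀ s t s' t' : ℝ≥0, s < t → t ≤ T → s' < t' → t' ≤ T →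
          dist s s' < δ → dist t t' < δ → ∀ μ : WassersteinSewing.PMoment H p,
            WassersteinSewing.wasserstein (θ s t μ) (θ s' t' μ) ≤
              (ε : ℝ≥0∞) * (1 + WassersteinSewing.moment μ)) := by

  refine ⟨WassersteinSewing.growthConst, fun T p _ C => WassersteinSewing.stabilityConst T p C, ?_⟩
  intro H _ _ _ _ _ _ p hp β hβ L C _ _ Θ hΘ hS _
  -- Limits are taken for `s = t` as well, as the flow property includes degenerate intervals; for
  -- `s > t` the value `id` is arbitrary.
  have hlim : ∀ s t : ℝ≥0, ∃ θ : WassersteinSewing.PMoment H p → WassersteinSewing.PMoment H p,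
      s ≤ t → ∀ μ, Tendsto (fun n => WassersteinSewing.wasserstein
        (WassersteinSewing.dyadicScheme Θ n s t μ) (θ μ)) atTop (𝓝 0) := by
    intro s t
    by_cases hst : s ≤ t
    · choose θ hθ using WassersteinSewing.exists_dyadicScheme_limit hS hp hβ hΘ hst
      exact ⟨θ, fun _ => hθ⟩
    · exact ⟨id, fun h => absurd h hst⟩
  choose θ hθ using hlim
  refine ⟨θ, ?_, fun s t hst => hθ s t hst.le, fun T _ => ⟨?_, ?_, ?_⟩⟩
  · intro s r t hsr hrt
    funext μ
    exact WassersteinSewing.limit_flow hS hp hβ hΘ hsr hrt (hθ s t (hsr.trans hrt) μ)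
      (hθ s r hsr μ) (hθ r t hrt _)
  · intro s t hst ht μ
    exact WassersteinSewing.moment_le_of_tendsto hS hp hst.le ht (hθ s t hst.le μ)
  · intro s t hst ht μ ν
    exact WassersteinSewing.wasserstein_limit_le hS hp hβ hΘ hst.le ht (hθ s t hst.le μ)
      (hθ s t hst.le ν)
  · intro ε hε
    set K := WassersteinSewing.continuityConst T p L C
    -- The modulus is `K (√δ + √δ)`, which dictates the square in `δ`; the `+ 1` avoids division by
    -- zero when `K = 0`.
    have hK : 0 < 2 * K + 1 := by positivity
    have hδ : 0 < (ε / (2 * K + 1)) ^ 2 := by positivity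
    refine ⟨((ε / (2 * K + 1)) ^ 2 : ℝ≥0), by exact_mod_cast hδ, ?_⟩
    intro s t s' t' hst ht hst' ht' hs hs' μ
    refine (WassersteinSewing.wasserstein_limit_times_le hS hp hβ hΘ hst.le ht hst'.le ht'
      (hθ s t hst.le μ) (hθ s' t' hst'.le μ)).trans ?_
    have root : ∀ x y : ℝ≥0, dist x y < ((ε / (2 * K + 1)) ^ 2 : ℝ≥0) →
        NNReal.sqrt (nndist x y) ≤ ε / (2 * K + 1) := fun x y h => by
      rw [← coe_nndist, NNReal.coe_lt_coe] at h
      exact NNReal.sqrt_le_iff_le_sq.2 h.le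
    gcongr ?_ * _
    rw [ENNReal.coe_le_coe]
    calc K * (NNReal.sqrt (nndist s s') + NNReal.sqrt (nndist t t'))
        ≤ K * (ε / (2 * K + 1) + ε / (2 * K + 1)) := by
          gcongr
          · exact root s s' hs
          · exact root t t' hs'
      _ = ε * (2 * K) / (2 * K + 1) := by ring
      _ ≤ ε := by
          rw [div_le_iff₀ hK]
          gcongr
          exact le_self_add
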